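/- For $f\in L^2(\mathbb R)$ let $\hat f(\xi)=\int_{\mathbb R} e^{-ix\xi}f(x)\,dx$ (in the $L^2$ sense), let $\|f\|_{H^s(\mathbb R)}=\|(1+\xi^2)^{s/2}\hat f(\xi)\|_{L^2(\mathbb R)}$, and put $$e^{it\Delta}f(x)=\frac1{2\pi}\lim_{R\to\infty}\int_{-R}^{R}e^{ix\xi+it\xi^2}\hat f(\xi)\,d\xi$$ wherever the limit exists. Let $0<\alpha<1$, $C_1\ge 1$, $C_2>0$, $x_0\in\mathbb R$, $r>0$ and $B(x_0,r)=(x_0-r,x_0+r)$. Let $\gamma:\mathbb R\times[0,1]\to\mathbb R$ satisfy, for all $x,y\in B(x_0,r)$ and $t,t'\in[0,1]$, $\gamma(x,0)=x$, $$C_1^{-1}|x-y|\le|\gamma(x,t)-\gamma(y,t)|\le C_1|x-y|,\qquad |\gamma(x,t)-\gamma(x,t')|\le C_2|t-t'|^{\alpha}.$$ Let $s\in\mathbb R$ and $p>0$ satisfy one of the following: (1) $\alpha\in[1/2,1)$, $s>1/4$ and $p\le4$; (2) $\alpha\in(1/4,1/2)$, $s>1/4$ and $p\le8\alpha$; (3)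 $\alpha\in(0,1/4]$, $s>1/2-\alpha$ and $p\le2$. Then there is a constant $C$, depending only on $\alpha,s,p,C_1,C_2$ and $B(x_0,r)$ (and not on $\gamma$ or $f$), such that for every $f\in H^s(\mathbb R)$ the following holds: for almost every $x\in B(x_0,r)$ the value $e^{it\Delta}f(\gamma(x,t))$ exists for all $t\in(0,1)$, the function $x\mapsto\sup_{0<t<1}|e^{it\Delta}f(\gamma(x,t))|$ is measurable on $B(x_0,r)$ (up to a null set), and $$\Bigl\|\sup_{0<t<1}|e^{it\Delta}f(\gamma(x,t))|\Bigr\|_{L^p(B(x_0,r))}\le C\,\|f\|_{H^s(\mathbb R)}.$$ -/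

import Mathlib

open MeasureTheory Filter Topology
open scoped NNReal ENNReal FourierTransform

noncomputable section

namespace TangentialSchrodinger

/-- The Fourier transform `f̂(ξ) = ∫ e^{-ixξ} f(x) dx` of `f ∈ L²(ℝ)` (a representative of the
`L²` class). Mathlib's `𝓕` has the kernel `e^{-2πixξ}`, hence the rescaling. -/
def fhat (f : Lp ℂ 2 (volume : Measure ℝ)) (ξ : ℝ) : ℂ :=
  (𝓕 f : Lp ℂ 2 (volume : Measure ℝ)) (ξ / (2 * Real.pi))

/-- `f ∈ H^s(ℝ)`, where `s ≥ 0`, so that `H^s(ℝ) ⊆ L²(ℝ)`. -/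
def MemH (s : ℝ) (f : Lp ℂ 2 (volume : Measure ℝ)) : Prop :=
  TemperedDistribution.MemSobolev s 2 (Lp.toTemperedDistribution f)

/-- `‖f‖_{H^s(ℝ)} = ‖(1 + ξ²)^{s/2} f̂(ξ)‖_{L²}`. -/
def normH (s : ℝ) (f : Lp ℂ 2 (volume : Measure ℝ)) : ℝ≥0∞ :=
  eLpNorm (fun ξ : ℝ => (((1 + ξ ^ 2) ^ (s / 2) : ℝ) : ℂ) * fhat f ξ) 2 volume

/-- The truncated integral `(2π)⁻¹ ∫_{-R}^{R} e^{ixξ + itξ²} f̂(ξ) dξ`. -/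
def schrodingerTrunc (f : Lp ℂ 2 (volume : Measure ℝ)) (t x R : ℝ) : ℂ :=
  (2 * Real.pi : ℂ)⁻¹ *
    ∫ ξ in (-R)..R, Complex.exp (Complex.I * ((x * ξ + t * ξ ^ 2 : ℝ) : ℂ)) * fhat f ξ

/-- `e^{itΔ} f(x) = (2π)⁻¹ ∫ e^{ixξ + itξ²} f̂(ξ) dξ`. For `f ∈ H^s` with `s ≤ 1/2` the function
`f̂` need not be integrable, so the integral is the limit of its truncations; where `f̂` is
integrable this is the Lebesgue integral. -/
def schrodinger (f : Lp ℂ 2 (volume : Measure ℝ)) (t x : ℝ) : ℂ :=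
  limUnder atTop (schrodingerTrunc f t x)

/-- The maximal function `sup_{0 < t < 1} |e^{itΔ} f(γ(x,t))|`, with values in `[0,∞]`. -/
def maximalFunction (γ : ℝ → ℝ → ℝ) (f : Lp ℂ 2 (volume : Measure ℝ)) (x : ℝ) : ℝ≥0∞ :=
  ⨆ t ∈ Set.Ioo (0 : ℝ) 1, ‖schrodinger f t (γ x t)‖ₑ

/-- On `B(x₀,r) × [0,1]`, the map `γ` starts at the identity, is bi-Lipschitz in `x` with
constant `C₁` and Hölder continuous of order `α` in `t` with constant `C₂`. -/
structure IsTangentialCurve (α C₁ C₂ x₀ r : ℝ) (γ : ℝ → ℝ → ℝ) : Prop where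
  start : ∀ x ∈ Metric.ball x₀ r, γ x 0 = x
  lower : ∀ x ∈ Metric.ball x₀ r, ∀ y ∈ Metric.ball x₀ r, ∀ t ∈ Set.Icc (0 : ℝ) 1,
    C₁⁻¹ * |x - y| ≤ |γ x t - γ y t|
  upper : ∀ x ∈ Metric.ball x₀ r, ∀ y ∈ Metric.ball x₀ r, ∀ t ∈ Set.Icc (0 : ℝ) 1,
    |γ x t - γ y t| ≤ C₁ * |x - y|
  holder : ∀ x ∈ Metric.ball x₀ r, ∀ t ∈ Set.Icc (0 : ℝ) 1, ∀ t' ∈ Set.Icc (0 : ℝ) 1,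
    |γ x t - γ x t'| ≤ C₂ * |t - t'| ^ α

/-- The maximal estimate on `L^p(B(x₀,r))` for all `f ∈ H^s(ℝ)`, with a constant `C` that does
not depend on `f`, nor on `γ` within the class given by `α, C₁, C₂` and the ball. It includes that
the left-hand side makes sense: for almost every `x` the values `e^{itΔ} f(γ(x,t))` exist for all
`t`, and the maximal function is measurable. -/
def MaximalEstimate (α C₁ C₂ x₀ r s p : ℝ) : Prop :=
  ∃ C : ℝ≥0, ∀ γ : ℝ → ℝ → ℝ, IsTangentialCurve α C₁ C₂ x₀ r γ →
    ∀ f : Lp ℂ 2 (volume : Measure ℝ), MemH s f →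
      (∀ᵐ x ∂(volume.restrict (Metric.ball x₀ r)), ∀ t ∈ Set.Ioo (0 : ℝ) 1,
        Tendsto (schrodingerTrunc f t (γ x t)) atTop (𝓝 (schrodinger f t (γ x t)))) ∧
      AEMeasurable (maximalFunction γ f) (volume.restrict (Metric.ball x₀ r)) ∧
      eLpNorm (maximalFunction γ f) (ENNReal.ofReal p) (volume.restrict (Metric.ball x₀ r))
        ≤ C * normH s f

end TangentialSchrodinger

end

/-!
Choose for each `x` a time `t(x)` and a truncation `R(x)` that nearly attain the supremum. This
linearizes the maximal operator, and by `TT*` its `L² → L^{2m}` bound follows from an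
`L^{2m/(2m-1)} → L^{2m}` bound for the kernel
`K(x, y) = ∫_{|ξ| ≤ R} (1 + ξ²)^{-s} e^{i(aξ + τξ²)} dξ`, where `R = min(R(x), R(y))`,
`a = γ(x, t(x)) - γ(y, t(y))` and `τ = t(x) - t(y)`. Since `γ` is bi-Lipschitz in `x` and
`α`-Hölder in `t`, either `|a| ≳ |x - y|` or `|τ|^α ≳ |x - y|`. The first and second derivative
tests then give `|K(x, y)| ≲ |x - y|^{-β}` as soon as `1 - β < 2s`, `1 - 2αβ < 2s` and `s > 1/4`,
and Young's inequality closes the estimate when `βm < 1`. Finally, the maximal bound applied to the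
tails `|ξ| > N` of `f̂` shows that the truncated integrals converge uniformly in `t` for almost
every `x`.
-/

noncomputable section

namespace TangentialSchrodinger

/-- The unimodular factor `e^{i(aξ + τξ²)}`. -/
def chirp (a τ ξ : ℝ) : ℂ := Complex.exp (Complex.I * ((a * ξ + τ * ξ ^ 2 : ℝ) : ℂ))

lemma norm_chirp (a τ ξ : ℝ) : ‖chirp a τ ξ‖ = 1 := by
  rw [chirp, mul_comm, Complex.norm_exp_ofReal_mul_I]

lemma continuous_chirp : Continuous fun q : ℝ × ℝ × ℝ => chirp q.1 q.2.1 q.2.2 := by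
  unfold chirp
  fun_prop

@[fun_prop]
lemma continuous_chirp_right (a τ : ℝ) : Continuous (chirp a τ) := by
  unfold chirp
  fun_prop

lemma intervalIntegrable_chirp (a τ c d : ℝ) : IntervalIntegrable (chirp a τ) volume c d :=
  (continuous_chirp_right a τ).intervalIntegrable c d

lemma chirp_neg_right (a τ ξ : ℝ) : chirp a τ (-ξ) = chirp (-a) τ ξ := by
  simp [chirp]

lemma chirp_mul_conj (a τ a' τ' ξ : ℝ) :
    chirp a τ ξ * (starRingEnd ℂ) (chirp a' τ' ξ) = chirp (a - a') (τ - τ') ξ := by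
  simp only [chirp, ← Complex.exp_conj, ← Complex.exp_add]
  congr 1
  simp only [map_mul, Complex.conj_I, Complex.conj_ofReal]
  push_cast
  ring

lemma norm_integral_cexp_phase_le {φ φ' φ'' : ℝ → ℝ} {c d : ℝ} (hcd : c ≤ d)
    (hφ : ∀ ξ ∈ Set.Icc c d, HasDerivAt φ (φ' ξ) ξ)
    (hφ' : ∀ ξ ∈ Set.Icc c d, HasDerivAt φ' (φ'' ξ) ξ)
    (hφ'' : ContinuousOn φ'' (Set.Icc c d)) (hne : ∀ ξ ∈ Set.Icc c d, φ' ξ ≠ 0) :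
    ‖∫ ξ in c..d, Complex.exp (Complex.I * φ ξ)‖ ≤
      |φ' c|⁻¹ + |φ' d|⁻¹ + ∫ ξ in c..d, |φ'' ξ| / φ' ξ ^ 2 := by
  rw [← Set.uIcc_of_le hcd] at hφ hφ' hφ'' hne
  have hφ'c : ContinuousOn φ' (Set.uIcc c d) := fun ξ hξ =>
    (hφ' ξ hξ).continuousAt.continuousWithinAt
  have hφc : ContinuousOn φ (Set.uIcc c d) := fun ξ hξ =>
    (hφ ξ hξ).continuousAt.continuousWithinAt
  set e : ℝ → ℂ := fun ξ => Complex.exp (Complex.I * φ ξ) with he_def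
  have he : ∀ ξ, ‖e ξ‖ = 1 := fun ξ => by
    simp only [he_def]
    rw [mul_comm, Complex.norm_exp_ofReal_mul_I]
  have hderiv_inv : ∀ ξ ∈ Set.uIcc c d, HasDerivAt (fun ξ => -Complex.I * ((φ' ξ)⁻¹ : ℝ))
      (-Complex.I * ((-φ'' ξ / φ' ξ ^ 2 : ℝ) : ℂ)) ξ := fun ξ hξ =>
    (((hφ' ξ hξ).fun_inv (hne ξ hξ)).ofReal_comp).const_mul _
  have hderiv_exp : ∀ ξ ∈ Set.uIcc c d, HasDerivAt e (e ξ * (Complex.I * φ' ξ)) ξ := fun ξ hξ =>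
    ((hφ ξ hξ).ofReal_comp.const_mul Complex.I).cexp
  have hcont_inv : ContinuousOn (fun ξ => -Complex.I * ((-φ'' ξ / φ' ξ ^ 2 : ℝ) : ℂ))
      (Set.uIcc c d) :=
    continuousOn_const.mul (Complex.continuous_ofReal.comp_continuousOn
      (hφ''.neg.div (hφ'c.pow 2) fun ξ hξ => pow_ne_zero 2 (hne ξ hξ)))
  have hcont_exp : ContinuousOn (fun ξ => e ξ * (Complex.I * φ' ξ)) (Set.uIcc c d) := by
    fun_prop
  have hparts := intervalIntegral.integral_mul_deriv_eq_deriv_mul hderiv_inv hderiv_exp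
    hcont_inv.intervalIntegrable hcont_exp.intervalIntegrable
  have hleft : ∀ ξ ∈ Set.uIcc c d,
      -Complex.I * ((φ' ξ)⁻¹ : ℝ) * (e ξ * (Complex.I * φ' ξ)) = e ξ := fun ξ hξ => by
    have : (φ' ξ : ℂ) ≠ 0 := Complex.ofReal_ne_zero.mpr (hne ξ hξ)
    push_cast
    field_simp
    simp
  have hrem : ‖∫ ξ in c..d, -Complex.I * ((-φ'' ξ / φ' ξ ^ 2 : ℝ) : ℂ) * e ξ‖ ≤
      ∫ ξ in c..d, |φ'' ξ| / φ' ξ ^ 2 := by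
    refine (intervalIntegral.norm_integral_le_integral_norm hcd).trans_eq
      (intervalIntegral.integral_congr fun ξ _ => ?_)
    simp [he]
  rw [intervalIntegral.integral_congr hleft] at hparts
  rw [hparts]
  refine (norm_sub_le _ _).trans (add_le_add ((norm_sub_le _ _).trans_eq ?_) hrem)
  simp [he, add_comm]

lemma norm_integral_chirp_le_of_ne_zero (a τ : ℝ) {c d : ℝ} (hcd : c ≤ d)
    (h : ∀ ξ ∈ Set.Icc c d, a + 2 * τ * ξ ≠ 0) :
    ‖∫ ξ in c..d, chirp a τ ξ‖ ≤ 2 / |a + 2 * τ * c| + 2 / |a + 2 * τ * d| := by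
  have hphase : ∀ ξ, HasDerivAt (fun ξ : ℝ => a * ξ + τ * ξ ^ 2) (a + 2 * τ * ξ) ξ := fun ξ => by
    convert! ((hasDerivAt_id ξ).const_mul a).add (((hasDerivAt_id ξ).pow 2).const_mul τ) using 1
    simp
    ring
  have hphase' : ∀ ξ, HasDerivAt (fun ξ : ℝ => a + 2 * τ * ξ) (2 * τ) ξ := fun ξ => by
    simpa using ((hasDerivAt_id ξ).const_mul (2 * τ)).const_add a
  have hinv : ∀ ξ ∈ Set.uIcc c d, HasDerivAt (fun ξ : ℝ => (a + 2 * τ * ξ)⁻¹)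
      (-(2 * τ) / (a + 2 * τ * ξ) ^ 2) ξ := fun ξ hξ =>
    (hphase' ξ).fun_inv (h ξ (Set.uIcc_of_le hcd ▸ hξ))
  have hcont : ContinuousOn (fun ξ : ℝ => -(2 * τ) / (a + 2 * τ * ξ) ^ 2) (Set.uIcc c d) :=
    ContinuousOn.div (by fun_prop) (by fun_prop) fun ξ hξ =>
      pow_ne_zero _ (h ξ (Set.uIcc_of_le hcd ▸ hξ))
  have hvar : ∫ ξ in c..d, |2 * τ| / (a + 2 * τ * ξ) ^ 2 ≤
      |(a + 2 * τ * d)⁻¹ - (a + 2 * τ * c)⁻¹| := by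
    rw [← intervalIntegral.integral_eq_sub_of_hasDerivAt hinv hcont.intervalIntegrable]
    simp only [div_eq_mul_inv]
    rw [intervalIntegral.integral_const_mul, intervalIntegral.integral_const_mul,
      abs_mul (-(2 * τ)), abs_neg]
    gcongr
    exact le_abs_self _
  have hmain := norm_integral_cexp_phase_le hcd (fun ξ _ => hphase ξ) (fun ξ _ => hphase' ξ)
    continuousOn_const h
  have htri := abs_sub (a + 2 * τ * d)⁻¹ (a + 2 * τ * c)⁻¹
  rw [abs_inv, abs_inv] at htri
  rw [div_eq_mul_inv, div_eq_mul_inv]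
  unfold chirp
  linarith

lemma norm_integral_chirp_le_self (a τ : ℝ) {v : ℝ} (hv : 0 ≤ v) :
    ‖∫ ξ in (0 : ℝ)..v, chirp a τ ξ‖ ≤ v := by
  simpa [abs_of_nonneg hv] using intervalIntegral.norm_integral_le_of_norm_le_const
    (a := 0) (b := v) (C := 1) fun ξ _ => (norm_chirp a τ ξ).le

lemma integral_chirp_neg_zero (a τ R : ℝ) :
    ∫ ξ in (0 : ℝ)..(-R), chirp a τ ξ = -∫ ξ in (0 : ℝ)..R, chirp (-a) τ ξ := by
  have hrefl := intervalIntegral.integral_comp_neg (a := 0) (b := R) (chirp a τ)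
  simp only [chirp_neg_right, neg_zero] at hrefl
  rw [hrefl, intervalIntegral.integral_symm]

lemma norm_integral_chirp_zero_le {τ : ℝ} (hτ : τ ≠ 0) (d : ℝ) :
    ‖∫ ξ in (0 : ℝ)..d, chirp 0 τ ξ‖ ≤ 3 * |τ| ^ (-(1 / 2) : ℝ) := by
  wlog hd : 0 ≤ d generalizing d
  · have h := this (-d) (by linarith)
    rwa [integral_chirp_neg_zero, norm_neg, neg_zero] at h
  have hτ' : 0 < |τ| := abs_pos.mpr hτ
  set δ := |τ| ^ (-(1 / 2) : ℝ) with hδ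
  have hδ0 : 0 < δ := Real.rpow_pos_of_pos hτ' _
  have hτδ : |τ| * δ = δ⁻¹ := by
    rw [hδ, ← Real.rpow_neg hτ'.le, ← Real.rpow_one_add' hτ'.le (by norm_num)]
    norm_num
  rcases le_total d δ with h | h
  · exact (norm_integral_chirp_le_self 0 τ hd).trans (by linarith)
  have hfar := norm_integral_chirp_le_of_ne_zero 0 τ h fun ξ hξ => by
    have : 0 < ξ := hδ0.trans_le hξ.1
    simp only [zero_add]
    positivity
  have hend : 2 / |0 + 2 * τ * δ| = δ := by
    rw [zero_add, abs_mul, abs_mul, abs_of_pos hδ0, mul_assoc, hτδ, abs_two]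
    field_simp
  have hmono : 2 / |0 + 2 * τ * d| ≤ 2 / |0 + 2 * τ * δ| := by
    simp only [zero_add, abs_mul, abs_of_pos hδ0, abs_of_nonneg hd, abs_two]
    gcongr
  rw [← intervalIntegral.integral_add_adjacent_intervals
    (intervalIntegrable_chirp 0 τ 0 δ) (intervalIntegrable_chirp 0 τ δ d)]
  refine (norm_add_le _ _).trans ?_
  linarith [norm_integral_chirp_le_self 0 τ hδ0.le]

lemma norm_integral_chirp_le_rpow (a : ℝ) {τ : ℝ} (hτ : τ ≠ 0) (c d : ℝ) :
    ‖∫ ξ in c..d, chirp a τ ξ‖ ≤ 6 * |τ| ^ (-(1 / 2) : ℝ) := by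
  set b := a / (2 * τ) with hb
  have hsquare : ∀ ξ, chirp a τ ξ = chirp 0 τ (ξ + b) *
      Complex.exp (((-(τ * b ^ 2) : ℝ) : ℂ) * Complex.I) := fun ξ => by
    have : a = 2 * τ * b := by rw [hb]; field_simp
    simp only [chirp, ← Complex.exp_add, this]
    congr 1
    push_cast
    ring
  simp only [hsquare]
  rw [intervalIntegral.integral_mul_const, norm_mul, Complex.norm_exp_ofReal_mul_I, mul_one,
    intervalIntegral.integral_comp_add_right (chirp 0 τ),
    ← intervalIntegral.integral_interval_sub_left
      (intervalIntegrable_chirp 0 τ 0 _) (intervalIntegrable_chirp 0 τ 0 _)]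
  refine (norm_sub_le _ _).trans ?_
  linarith [norm_integral_chirp_zero_le hτ (d + b), norm_integral_chirp_zero_le hτ (c + b)]

lemma norm_integral_chirp_le_div {a τ v : ℝ} (hv : 0 ≤ v) (ha : a ≠ 0) (h : 4 * v * |τ| ≤ |a|) :
    ‖∫ ξ in (0 : ℝ)..v, chirp a τ ξ‖ ≤ 8 / |a| := by
  have ha' : 0 < |a| := abs_pos.mpr ha
  have hlow : ∀ ξ ∈ Set.Icc 0 v, |a| / 2 ≤ |a + 2 * τ * ξ| := fun ξ hξ => by
    have hquad : |2 * τ * ξ| ≤ |a| / 2 := by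
      rw [abs_mul, abs_mul, abs_two, abs_of_nonneg hξ.1]
      nlinarith [mul_le_mul_of_nonneg_left hξ.2 (abs_nonneg τ)]
    have htri := abs_sub_abs_le_abs_sub a (-(2 * τ * ξ))
    rw [abs_neg, sub_neg_eq_add] at htri
    linarith
  have hterm : ∀ ξ ∈ Set.Icc 0 v, 2 / |a + 2 * τ * ξ| ≤ 4 / |a| := fun ξ hξ => by
    have := hlow ξ hξ
    rw [div_le_div_iff₀ (by linarith) ha']
    linarith
  calc ‖∫ ξ in (0 : ℝ)..v, chirp a τ ξ‖
      ≤ 2 / |a + 2 * τ * 0| + 2 / |a + 2 * τ * v| :=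
        norm_integral_chirp_le_of_ne_zero a τ hv fun ξ hξ =>
          abs_pos.mp ((half_pos ha').trans_le (hlow ξ hξ))
    _ ≤ 4 / |a| + 4 / |a| := add_le_add (hterm 0 ⟨le_rfl, hv⟩) (hterm v ⟨hv, le_rfl⟩)
    _ = 8 / |a| := by ring

lemma norm_integral_chirp_le_rpow_div {a v : ℝ} (τ : ℝ) (ha : a ≠ 0) (hv : 0 ≤ v) :
    ‖∫ ξ in (0 : ℝ)..v, chirp a τ ξ‖ ≤ 12 * (v / |a|) ^ (1 / 2 : ℝ) := by
  have ha' : 0 < |a| := abs_pos.mpr ha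
  rw [← Real.sqrt_eq_rpow]
  rcases le_or_gt (4 * v * |τ|) |a| with h | h
  · have hsq : ‖∫ ξ in (0 : ℝ)..v, chirp a τ ξ‖ ^ 2 ≤ 12 ^ 2 * (v / |a|) := by
      calc ‖∫ ξ in (0 : ℝ)..v, chirp a τ ξ‖ ^ 2
          = ‖∫ ξ in (0 : ℝ)..v, chirp a τ ξ‖ * ‖∫ ξ in (0 : ℝ)..v, chirp a τ ξ‖ := sq _
        _ ≤ v * (8 / |a|) := by
            gcongr
            exacts [norm_integral_chirp_le_self a τ hv, norm_integral_chirp_le_div hv ha h]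
        _ = 8 * (v / |a|) := by ring
        _ ≤ 12 ^ 2 * (v / |a|) := by gcongr; norm_num
    rw [← Real.sqrt_sq (by norm_num : (0 : ℝ) ≤ 12), ← Real.sqrt_mul (by positivity)]
    exact Real.le_sqrt_of_sq_le hsq
  · have hτ : 0 < |τ| := by
      by_contra! hτ
      nlinarith [mul_nonpos_of_nonneg_of_nonpos hv hτ]
    have hinv : |τ|⁻¹ ≤ 2 ^ 2 * (v / |a|) := by
      rw [inv_le_iff_one_le_mul₀ hτ, mul_div_assoc', div_mul_eq_mul_div, one_le_div ha']
      linarith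
    calc ‖∫ ξ in (0 : ℝ)..v, chirp a τ ξ‖ ≤ 6 * |τ| ^ (-(1 / 2) : ℝ) :=
          norm_integral_chirp_le_rpow a (abs_pos.mp hτ) 0 v
      _ = 6 * √|τ|⁻¹ := by rw [Real.rpow_neg hτ.le, Real.sqrt_inv, Real.sqrt_eq_rpow]
      _ ≤ 6 * √(2 ^ 2 * (v / |a|)) := by gcongr
      _ = 12 * √(v / |a|) := by
          rw [Real.sqrt_mul (by norm_num), Real.sqrt_sq (by norm_num)]
          ring

lemma rpow_le_one_add_sq_rpow {v e κ : ℝ} (hv : 0 ≤ v) (he : 0 ≤ e) (h : e ≤ κ) :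
    v ^ e ≤ (1 + v ^ 2) ^ (κ / 2) := by
  calc v ^ e = (v ^ 2) ^ (e / 2) := by
        rw [← Real.rpow_natCast_mul hv]
        congr 1
        push_cast
        ring
    _ ≤ (1 + v ^ 2) ^ (e / 2) := by gcongr; linarith
    _ ≤ (1 + v ^ 2) ^ (κ / 2) :=
        Real.rpow_le_rpow_of_exponent_le (by nlinarith) (by linarith)

lemma le_rpow_mul_rpow_of_le {I v A θ : ℝ} (hI : 0 ≤ I) (h0 : 0 ≤ θ) (h1 : θ ≤ 1)
    (hv : I ≤ v) (hA : I ≤ A) : I ≤ v ^ (1 - θ) * A ^ θ := by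
  have : 0 ≤ 1 - θ := by linarith
  have : 0 ≤ v := hI.trans hv
  calc I = I ^ (1 - θ) * I ^ θ := by rw [← Real.rpow_add' hI (by norm_num)]; norm_num
    _ ≤ v ^ (1 - θ) * A ^ θ := by gcongr

lemma le_mul_rpow_of_le_of_le {I v u L M δ σ θ β κ : ℝ} (hI : 0 ≤ I) (hIv : I ≤ v)
    (hIM : I ≤ M * v ^ δ * u ^ (-σ)) (hM : 0 ≤ M) (hδ : 0 ≤ δ) (hu : 0 < u) (huL : u ≤ L)
    (hθ₀ : 0 ≤ θ) (hθ₁ : θ ≤ 1) (hβ : σ * θ ≤ β) (hκ : 1 - θ + δ * θ ≤ κ) :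
    I ≤ M ^ θ * L ^ (β - σ * θ) * (1 + v ^ 2) ^ (κ / 2) * u ^ (-β) := by
  have hv : 0 ≤ v := hI.trans hIv
  have hθ : 0 ≤ 1 - θ := by linarith
  have : 0 ≤ β - σ * θ := by linarith
  calc I ≤ v ^ (1 - θ) * (M * v ^ δ * u ^ (-σ)) ^ θ := le_rpow_mul_rpow_of_le hI hθ₀ hθ₁ hIv hIM
    _ = M ^ θ * u ^ (-(σ * θ)) * v ^ (1 - θ + δ * θ) := by
        rw [Real.mul_rpow (by positivity) (by positivity), Real.mul_rpow hM (by positivity),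
          ← Real.rpow_mul hv, ← Real.rpow_mul hu.le, neg_mul,
          Real.rpow_add_of_nonneg hv hθ (by positivity)]
        ring
    _ = M ^ θ * (u ^ (β - σ * θ) * u ^ (-β)) * v ^ (1 - θ + δ * θ) := by
        rw [← Real.rpow_add hu]
        ring_nf
    _ ≤ M ^ θ * (L ^ (β - σ * θ) * u ^ (-β)) * (1 + v ^ 2) ^ (κ / 2) := by
        have : 0 ≤ L := hu.le.trans huL
        gcongr
        exact rpow_le_one_add_sq_rpow hv (by positivity) hκ
    _ = M ^ θ * L ^ (β - σ * θ) * (1 + v ^ 2) ^ (κ / 2) * u ^ (-β) := by ring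

lemma norm_integral_chirp_le_of_le_abs {D u a v : ℝ} (τ : ℝ) (hu : 0 < u) (hv : 0 ≤ v)
    (h : u ≤ D * |a|) :
    ‖∫ ξ in (0 : ℝ)..v, chirp a τ ξ‖ ≤
      12 * D ^ (1 / 2 : ℝ) * v ^ (1 / 2 : ℝ) * u ^ (-(1 / 2) : ℝ) := by
  have ha : a ≠ 0 := by
    rintro rfl
    simp only [abs_zero, mul_zero] at h
    linarith
  have ha' : 0 < |a| := abs_pos.mpr ha
  have hD : 0 < D := pos_of_mul_pos_left (hu.trans_le h) ha'.le
  calc ‖∫ ξ in (0 : ℝ)..v, chirp a τ ξ‖ ≤ 12 * (v / |a|) ^ (1 / 2 : ℝ) :=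
        norm_integral_chirp_le_rpow_div τ ha hv
    _ ≤ 12 * (D * v / u) ^ (1 / 2 : ℝ) := by
        gcongr 12 * ?_ ^ (1 / 2 : ℝ)
        rw [div_le_div_iff₀ ha' hu]
        nlinarith
    _ = _ := by
        rw [Real.div_rpow (by positivity) hu.le, Real.mul_rpow hD.le hv, Real.rpow_neg hu.le]
        ring

lemma norm_integral_chirp_le_of_le_rpow {α D u τ : ℝ} (a : ℝ) (hα : 0 < α) (hu : 0 < u)
    (h : u ≤ D * |τ| ^ α) (v : ℝ) :
    ‖∫ ξ in (0 : ℝ)..v, chirp a τ ξ‖ ≤ 6 * D ^ (1 / (2 * α)) * u ^ (-(1 / (2 * α))) := by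
  have hτ : τ ≠ 0 := by
    rintro rfl
    simp only [abs_zero, Real.zero_rpow hα.ne', mul_zero] at h
    linarith
  have hτ' : 0 < |τ| := abs_pos.mpr hτ
  have hD : 0 < D := pos_of_mul_pos_left (hu.trans_le h) (by positivity)
  calc ‖∫ ξ in (0 : ℝ)..v, chirp a τ ξ‖ ≤ 6 * |τ| ^ (-(1 / 2) : ℝ) :=
        norm_integral_chirp_le_rpow a hτ 0 v
    _ = 6 * ((|τ| ^ α)⁻¹) ^ (1 / (2 * α)) := by
        rw [← Real.rpow_neg hτ'.le, ← Real.rpow_mul hτ'.le]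
        congr 2
        field_simp
    _ ≤ 6 * (D / u) ^ (1 / (2 * α)) := by
        gcongr
        rw [inv_le_comm₀ (by positivity) (by positivity), inv_div, div_le_iff₀ hD]
        linarith
    _ = _ := by
        rw [Real.div_rpow hD.le hu.le, Real.rpow_neg hu.le]
        ring

/-- The trivial bound `v` is interpolated with the van der Corput bounds; the truncations of the
interpolation exponents at `1` are why `κ` must be at least `1/2`. -/
lemma exists_norm_integral_chirp_le {α C₁ C₂ β κ : ℝ} (hα : 0 < α) (hC₁ : 0 < C₁) (hC₂ : 0 < C₂)
    (hβ : 0 < β) (hκ₀ : 1 / 2 ≤ κ) (hκ₁ : 1 - β ≤ κ) (hκ₂ : 1 - 2 * α * β ≤ κ) (L : ℝ) :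
    ∃ K, ∀ u a τ v : ℝ, 0 < u → u ≤ L → 0 ≤ v → C₁⁻¹ * u ≤ |a| + C₂ * |τ| ^ α →
      ‖∫ ξ in (0 : ℝ)..v, chirp a τ ξ‖ ≤ K * (1 + v ^ 2) ^ (κ / 2) * u ^ (-β) := by
  set θ := min 1 (2 * β) with hθ
  set η := min 1 (2 * α * β) with hη
  set A := (12 * (2 * C₁) ^ (1 / 2 : ℝ)) ^ θ * L ^ (β - 1 / 2 * θ)
  set B := (6 * (2 * C₁ * C₂) ^ (1 / (2 * α))) ^ η * L ^ (β - 1 / (2 * α) * η)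
  refine ⟨max A B, fun u a τ v hu huL hv h => ?_⟩
  suffices ∃ K ≤ max A B, ‖∫ ξ in (0 : ℝ)..v, chirp a τ ξ‖ ≤
      K * (1 + v ^ 2) ^ (κ / 2) * u ^ (-β) by
    obtain ⟨K, hK, hle⟩ := this
    exact hle.trans (by gcongr)
  rcases le_total u (2 * C₁ * |a|) with ha | ha
  · refine ⟨A, le_max_left A B, le_mul_rpow_of_le_of_le (norm_nonneg _)
      (norm_integral_chirp_le_self a τ hv) (norm_integral_chirp_le_of_le_abs τ hu hv ha)
      (by positivity) (by norm_num) hu huL (le_min zero_le_one (by linarith)) (min_le_left _ _)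
      ?_ ?_⟩
    · linarith [min_le_right 1 (2 * β)]
    · rcases min_choice 1 (2 * β) with h' | h' <;> rw [hθ, h'] <;> linarith
  · have hτ : u ≤ 2 * C₁ * C₂ * |τ| ^ α := by
      rw [inv_mul_le_iff₀ hC₁] at h
      linarith
    have hchirp := norm_integral_chirp_le_of_le_rpow a hα hu hτ v
    refine ⟨B, le_max_right A B, le_mul_rpow_of_le_of_le (δ := 0) (norm_nonneg _)
      (norm_integral_chirp_le_self a τ hv) (by rwa [Real.rpow_zero, mul_one])
      (by positivity) le_rfl hu huL (le_min zero_le_one (by positivity)) (min_le_left _ _) ?_ ?_⟩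
    · rw [div_mul_eq_mul_div, one_mul, div_le_iff₀ (by positivity)]
      linarith [min_le_right 1 (2 * α * β)]
    · rcases min_choice 1 (2 * α * β) with h' | h' <;> rw [hη, h'] <;> linarith

lemma hasDerivAt_one_add_sq_rpow (e ξ : ℝ) :
    HasDerivAt (fun ξ : ℝ => (1 + ξ ^ 2) ^ e) (2 * e * ξ * (1 + ξ ^ 2) ^ (e - 1)) ξ := by
  have hbase : HasDerivAt (fun ξ : ℝ => 1 + ξ ^ 2) (2 * ξ) ξ := by
    simpa using ((hasDerivAt_id ξ).pow 2).const_add 1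
  convert! hbase.rpow_const (p := e) (Or.inl (by positivity)) using 1
  ring

@[fun_prop]
lemma continuous_one_add_sq_rpow (e : ℝ) : Continuous fun ξ : ℝ => (1 + ξ ^ 2) ^ e :=
  continuous_iff_continuousAt.mpr fun ξ => (hasDerivAt_one_add_sq_rpow e ξ).continuousAt

lemma norm_integral_smul_le_of_norm_primitive_le {E : Type*} [NormedAddCommGroup E]
    [NormedSpace ℝ E] [CompleteSpace E] {f : ℝ → E} {w w' B : ℝ → ℝ} {R : ℝ} (hR : 0 ≤ R)
    (hf : Continuous f) (hw : ∀ ξ, HasDerivAt w (w' ξ) ξ) (hw' : Continuous w') (hB : Continuous B)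
    (h : ∀ v, 0 ≤ v → ‖∫ ξ in (0 : ℝ)..v, f ξ‖ ≤ B v) :
    ‖∫ ξ in (0 : ℝ)..R, w ξ • f ξ‖ ≤ |w R| * B R + ∫ ξ in (0 : ℝ)..R, |w' ξ| * B ξ := by
  set F : ℝ → E := fun v => ∫ ξ in (0 : ℝ)..v, f ξ
  have hF' : ∀ v, HasDerivAt F (f v) v := fun v => hf.integral_hasStrictDerivAt 0 v |>.hasDerivAt
  have hparts := intervalIntegral.integral_smul_deriv_eq_deriv_smul (a := 0) (b := R)
    (fun ξ _ => hw ξ) (fun ξ _ => hF' ξ) (hw'.intervalIntegrable _ _) (hf.intervalIntegrable _ _)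
  have hrem : ‖∫ ξ in (0 : ℝ)..R, w' ξ • F ξ‖ ≤ ∫ ξ in (0 : ℝ)..R, |w' ξ| * B ξ := by
    refine intervalIntegral.norm_integral_le_of_norm_le hR (ae_of_all _ fun ξ hξ => ?_)
      ((hw'.abs.mul hB).intervalIntegrable _ _)
    rw [norm_smul, Real.norm_eq_abs]
    gcongr
    exact h ξ hξ.1.le
  have hbdry : ‖w R • F R‖ ≤ |w R| * B R := by
    rw [norm_smul, Real.norm_eq_abs]
    gcongr
    exact h R hR
  have hF0 : F 0 = 0 := intervalIntegral.integral_same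
  rw [hparts, hF0, smul_zero, sub_zero]
  exact (norm_sub_le _ _).trans (add_le_add hbdry hrem)

lemma integral_abs_deriv_one_add_sq_rpow_mul {s e R : ℝ} (hs : 0 ≤ s) (he : e ≠ s) (hR : 0 ≤ R) :
    ∫ ξ in (0 : ℝ)..R, |2 * -s * ξ * (1 + ξ ^ 2) ^ (-s - 1)| * (1 + ξ ^ 2) ^ e =
      s / (s - e) * (1 - (1 + R ^ 2) ^ (e - s)) := by
  have hne : s - e ≠ 0 := sub_ne_zero.mpr he.symm
  have hprim : ∀ ξ ∈ Set.uIcc 0 R, |2 * -s * ξ * (1 + ξ ^ 2) ^ (-s - 1)| * (1 + ξ ^ 2) ^ e =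
      -(s / (s - e)) * (2 * (e - s) * ξ * (1 + ξ ^ 2) ^ (e - s - 1)) := fun ξ hξ => by
    have hξ : 0 ≤ ξ := by rw [Set.uIcc_of_le hR] at hξ; exact hξ.1
    rw [show 2 * -s * ξ = -(2 * s * ξ) by ring, neg_mul, abs_neg, abs_of_nonneg (by positivity),
      show e - s - 1 = e + (-s - 1) by ring, Real.rpow_add (by positivity),
      show e - s = -(s - e) by ring]
    field_simp
  rw [intervalIntegral.integral_congr hprim, intervalIntegral.integral_const_mul,
    intervalIntegral.integral_eq_sub_of_hasDerivAt
      (fun ξ _ => hasDerivAt_one_add_sq_rpow (e - s) ξ)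
      (Continuous.intervalIntegrable (by fun_prop) _ _)]
  norm_num
  ring

lemma norm_integral_one_add_sq_rpow_smul_le {E : Type*} [NormedAddCommGroup E]
    [NormedSpace ℝ E] [CompleteSpace E] {f : ℝ → E} {s e A R : ℝ} (hf : Continuous f)
    (hs₀ : 0 ≤ s) (hs : e < s) (hR : 0 ≤ R)
    (h : ∀ v, 0 ≤ v → ‖∫ ξ in (0 : ℝ)..v, f ξ‖ ≤ A * (1 + v ^ 2) ^ e) :
    ‖∫ ξ in (0 : ℝ)..R, ((1 + ξ ^ 2) ^ (-s) : ℝ) • f ξ‖ ≤ A * (1 + s / (s - e)) := by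
  have : 0 < s - e := by linarith
  have hA : 0 ≤ A := by simpa using h 0 le_rfl
  have hparts := norm_integral_smul_le_of_norm_primitive_le hR hf (hasDerivAt_one_add_sq_rpow (-s))
    (by fun_prop) (by fun_prop) h
  have hbdry : |(1 + R ^ 2) ^ (-s)| * (A * (1 + R ^ 2) ^ e) = A * (1 + R ^ 2) ^ (e - s) := by
    rw [abs_of_nonneg (by positivity), mul_left_comm, ← Real.rpow_add (by positivity)]
    ring_nf
  simp only [mul_left_comm _ A] at hparts hbdry
  rw [hbdry, intervalIntegral.integral_const_mul,
    integral_abs_deriv_one_add_sq_rpow_mul hs₀ hs.ne hR, ← mul_add] at hparts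
  have hdecay : (1 + R ^ 2) ^ (e - s) ≤ 1 :=
    Real.rpow_le_one_of_one_le_of_nonpos (by nlinarith [sq_nonneg R]) (by linarith)
  have hpos : 0 ≤ (1 + R ^ 2) ^ (e - s) := by positivity
  calc _ ≤ A * ((1 + R ^ 2) ^ (e - s) + s / (s - e) * (1 - (1 + R ^ 2) ^ (e - s))) := hparts
    _ ≤ A * (1 + s / (s - e) * (1 - 0)) := by gcongr
    _ = _ := by rw [sub_zero, mul_one]

lemma integral_neg_self_one_add_sq_rpow_smul_chirp (s a τ R : ℝ) :
    ∫ ξ in (-R)..R, ((1 + ξ ^ 2) ^ (-s) : ℝ) • chirp a τ ξ =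
      (∫ ξ in (0 : ℝ)..R, ((1 + ξ ^ 2) ^ (-s) : ℝ) • chirp (-a) τ ξ) +
        ∫ ξ in (0 : ℝ)..R, ((1 + ξ ^ 2) ^ (-s) : ℝ) • chirp a τ ξ := by
  have hint : ∀ c d, IntervalIntegrable (fun ξ => ((1 + ξ ^ 2) ^ (-s) : ℝ) • chirp a τ ξ)
      volume c d := fun c d => Continuous.intervalIntegrable (by fun_prop) c d
  have hrefl := intervalIntegral.integral_comp_neg (a := 0) (b := R)
    fun ξ => ((1 + ξ ^ 2) ^ (-s) : ℝ) • chirp a τ ξ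
  simp only [chirp_neg_right, neg_zero, neg_sq] at hrefl
  rw [hrefl, intervalIntegral.integral_add_adjacent_intervals (hint _ _) (hint _ _)]

lemma exists_norm_integral_one_add_sq_rpow_smul_chirp_le {α C₁ C₂ β s : ℝ} (hα : 0 < α)
    (hC₁ : 0 < C₁) (hC₂ : 0 < C₂) (hβ : 0 < β) (hs₀ : 1 / 4 < s) (hs₁ : 1 - β < 2 * s)
    (hs₂ : 1 - 2 * α * β < 2 * s) (L : ℝ) :
    ∃ K, ∀ u a τ R : ℝ, 0 < u → u ≤ L → 0 ≤ R → C₁⁻¹ * u ≤ |a| + C₂ * |τ| ^ α →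
      ‖∫ ξ in (-R)..R, ((1 + ξ ^ 2) ^ (-s) : ℝ) • chirp a τ ξ‖ ≤ K * u ^ (-β) := by
  set κ := max (1 / 2) (max (1 - β) (1 - 2 * α * β))
  have hκ : κ / 2 < s := by
    have : κ < 2 * s := max_lt (by linarith) (max_lt hs₁ hs₂)
    linarith
  obtain ⟨K, hK⟩ := exists_norm_integral_chirp_le hα hC₁ hC₂ hβ (κ := κ) (le_max_left _ _)
    ((le_max_left _ _).trans (le_max_right _ _)) ((le_max_right _ _).trans (le_max_right _ _)) L
  refine ⟨2 * (K * (1 + s / (s - κ / 2))), fun u a τ R hu huL hR hsep => ?_⟩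
  have hhalf : ∀ b, C₁⁻¹ * u ≤ |b| + C₂ * |τ| ^ α →
      ‖∫ ξ in (0 : ℝ)..R, ((1 + ξ ^ 2) ^ (-s) : ℝ) • chirp b τ ξ‖ ≤
        K * u ^ (-β) * (1 + s / (s - κ / 2)) := fun b hb =>
    norm_integral_one_add_sq_rpow_smul_le (by fun_prop) (by linarith) hκ hR fun v hv =>
      (hK u b τ v hu huL hv hb).trans_eq (by ring)
  rw [integral_neg_self_one_add_sq_rpow_smul_chirp]
  calc _ ≤ K * u ^ (-β) * (1 + s / (s - κ / 2)) + K * u ^ (-β) * (1 + s / (s - κ / 2)) :=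
        norm_add_le_of_le (hhalf (-a) (by rwa [abs_neg])) (hhalf a hsep)
    _ = _ := by ring

section Kernels

variable {X Y : Type*} [MeasurableSpace X] [MeasurableSpace Y]

lemma lintegral_rpow_mul_rpow_mul_rpow_le {μ : Measure X} {u v w : X → ℝ≥0∞}
    (hu : AEMeasurable u μ) (hv : AEMeasurable v μ) (hw : AEMeasurable w μ) {a b c : ℝ}
    (ha : 0 ≤ a) (hb : 0 ≤ b) (hc : 0 ≤ c) (habc : a + b + c = 1) :
    ∫⁻ x, u x ^ a * v x ^ b * w x ^ c ∂μ ≤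
      (∫⁻ x, u x ∂μ) ^ a * (∫⁻ x, v x ∂μ) ^ b * (∫⁻ x, w x ∂μ) ^ c := by
  have h := ENNReal.lintegral_prod_norm_pow_le (μ := μ) Finset.univ (f := ![u, v, w])
    (p := ![a, b, c]) (by simp [Fin.forall_fin_succ, hu, hv, hw])
    (by simp [Fin.sum_univ_three, habc]) (by simp [Fin.forall_fin_succ, ha, hb, hc])
  simpa [Fin.prod_univ_three] using h

lemma lintegral_prod_fst_mul_le {μ : Measure X} {ν : Measure Y} [SFinite ν] {f : X → ℝ≥0∞}
    {k : X × Y → ℝ≥0∞} (hf : Measurable f) (hk : Measurable k) {A : ℝ≥0∞}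
    (hA : ∀ᵐ x ∂μ, ∫⁻ y, k (x, y) ∂ν ≤ A) :
    ∫⁻ z, f z.1 * k z ∂(μ.prod ν) ≤ (∫⁻ x, f x ∂μ) * A := by
  rw [lintegral_prod _ (by fun_prop), ← lintegral_mul_const _ hf]
  refine lintegral_mono_ae (hA.mono fun x hx => ?_)
  dsimp only
  rw [lintegral_const_mul _ (by fun_prop)]
  gcongr

lemma lintegral_prod_snd_mul_le {μ : Measure X} {ν : Measure Y} [SFinite μ] [SFinite ν]
    {g : Y → ℝ≥0∞} {k : X × Y → ℝ≥0∞} (hg : Measurable g) (hk : Measurable k) {B : ℝ≥0∞}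
    (hB : ∀ᵐ y ∂ν, ∫⁻ x, k (x, y) ∂μ ≤ B) :
    ∫⁻ z, g z.2 * k z ∂(μ.prod ν) ≤ (∫⁻ y, g y ∂ν) * B := by
  rw [← lintegral_prod_swap]
  exact lintegral_prod_fst_mul_le hg (hk.comp measurable_swap) hB

lemma mul_mul_eq_rpow_mul_rpow_mul_rpow {p q m : ℝ} (hp : 1 ≤ p) (hq : 1 ≤ q) (hm : 1 ≤ m)
    (hpqm : p⁻¹ + q⁻¹ + m⁻¹ = 2) (f g k : ℝ≥0∞) :
    f * g * k = (f ^ p * g ^ q) ^ (1 - m⁻¹) * (f ^ p * k ^ m) ^ (1 - q⁻¹) *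
      (g ^ q * k ^ m) ^ (1 - p⁻¹) := by
  have ha : 0 ≤ 1 - m⁻¹ := sub_nonneg.mpr (inv_le_one_of_one_le₀ hm)
  have hb : 0 ≤ 1 - q⁻¹ := sub_nonneg.mpr (inv_le_one_of_one_le₀ hq)
  have hc : 0 ≤ 1 - p⁻¹ := sub_nonneg.mpr (inv_le_one_of_one_le₀ hp)
  have split : ∀ {r a b : ℝ} (_ : 1 ≤ r) (_ : 0 ≤ a) (_ : 0 ≤ b) (_ : a + b = r⁻¹) (x : ℝ≥0∞),
      x = (x ^ r) ^ a * (x ^ r) ^ b := fun {r a b} hr ha hb hab x => by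
    rw [← ENNReal.rpow_add_of_nonneg _ _ ha hb, hab, ENNReal.rpow_rpow_inv (by linarith)]
  rw [ENNReal.mul_rpow_of_nonneg _ _ ha, ENNReal.mul_rpow_of_nonneg _ _ hb,
    ENNReal.mul_rpow_of_nonneg _ _ hc]
  nth_rw 1 [split hp ha hb (by linarith) f, split hq ha hc (by linarith) g,
    split hm hb hc (by linarith) k]
  ring

theorem lintegral_prod_mul_mul_le {μ : Measure X} {ν : Measure Y} [SFinite μ] [SFinite ν]
    {p q m : ℝ} (hp : 1 ≤ p) (hq : 1 ≤ q) (hm : 1 ≤ m) (hpqm : p⁻¹ + q⁻¹ + m⁻¹ = 2)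
    {f : X → ℝ≥0∞} (hf : Measurable f) {g : Y → ℝ≥0∞} (hg : Measurable g)
    {k : X × Y → ℝ≥0∞} (hk : Measurable k) {A B : ℝ≥0∞}
    (hA : ∀ᵐ x ∂μ, ∫⁻ y, k (x, y) ^ m ∂ν ≤ A) (hB : ∀ᵐ y ∂ν, ∫⁻ x, k (x, y) ^ m ∂μ ≤ B) :
    ∫⁻ z, f z.1 * g z.2 * k z ∂(μ.prod ν) ≤
      (∫⁻ x, f x ^ p ∂μ) ^ p⁻¹ * (∫⁻ y, g y ^ q ∂ν) ^ q⁻¹ * A ^ (1 - q⁻¹) * B ^ (1 - p⁻¹) := by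
  have ha : 0 ≤ 1 - m⁻¹ := sub_nonneg.mpr (inv_le_one_of_one_le₀ hm)
  have hb : 0 ≤ 1 - q⁻¹ := sub_nonneg.mpr (inv_le_one_of_one_le₀ hq)
  have hc : 0 ≤ 1 - p⁻¹ := sub_nonneg.mpr (inv_le_one_of_one_le₀ hp)
  set F := ∫⁻ x, f x ^ p ∂μ
  set G := ∫⁻ y, g y ^ q ∂ν
  calc ∫⁻ z, f z.1 * g z.2 * k z ∂(μ.prod ν)
      = ∫⁻ z, (f z.1 ^ p * g z.2 ^ q) ^ (1 - m⁻¹) * (f z.1 ^ p * k z ^ m) ^ (1 - q⁻¹) *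
          (g z.2 ^ q * k z ^ m) ^ (1 - p⁻¹) ∂(μ.prod ν) :=
        lintegral_congr fun z => mul_mul_eq_rpow_mul_rpow_mul_rpow hp hq hm hpqm _ _ _
    _ ≤ (∫⁻ z, f z.1 ^ p * g z.2 ^ q ∂(μ.prod ν)) ^ (1 - m⁻¹) *
          (∫⁻ z, f z.1 ^ p * k z ^ m ∂(μ.prod ν)) ^ (1 - q⁻¹) *
          (∫⁻ z, g z.2 ^ q * k z ^ m ∂(μ.prod ν)) ^ (1 - p⁻¹) :=
        lintegral_rpow_mul_rpow_mul_rpow_le (by fun_prop) (by fun_prop) (by fun_prop) ha hb hc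
          (by linarith)
    _ ≤ (F * G) ^ (1 - m⁻¹) * (F * A) ^ (1 - q⁻¹) * (G * B) ^ (1 - p⁻¹) := by
        gcongr
        · exact (lintegral_prod_mul (hf.pow_const p).aemeasurable
            (hg.pow_const q).aemeasurable).le
        · exact lintegral_prod_fst_mul_le (hf.pow_const p) (hk.pow_const m) hA
        · exact lintegral_prod_snd_mul_le (hg.pow_const q) (hk.pow_const m) hB
    _ = F ^ p⁻¹ * G ^ q⁻¹ * A ^ (1 - q⁻¹) * B ^ (1 - p⁻¹) := by
        have hF : F ^ p⁻¹ = F ^ (1 - m⁻¹) * F ^ (1 - q⁻¹) := by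
          rw [← ENNReal.rpow_add_of_nonneg _ _ ha hb]
          congr 1
          linarith
        have hG : G ^ q⁻¹ = G ^ (1 - m⁻¹) * G ^ (1 - p⁻¹) := by
          rw [← ENNReal.rpow_add_of_nonneg _ _ ha hc]
          congr 1
          linarith
        rw [ENNReal.mul_rpow_of_nonneg _ _ ha, ENNReal.mul_rpow_of_nonneg _ _ hb,
          ENNReal.mul_rpow_of_nonneg _ _ hc, hF, hG]
        ring

variable {𝕜 : Type*} [RCLike 𝕜]

lemma enorm_integral_rclike_ofReal {μ : Measure X} {f : X → ℝ} (hf : Integrable f μ)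
    (h0 : ∀ x, 0 ≤ f x) : ‖∫ x, (f x : 𝕜) ∂μ‖ₑ = ∫⁻ x, ENNReal.ofReal (f x) ∂μ := by
  rw [integral_ofReal, ← ofReal_norm, RCLike.norm_ofReal, abs_of_nonneg (integral_nonneg h0),
    ofReal_integral_eq_lintegral_ofReal hf (ae_of_all _ h0)]

lemma lintegral_enorm_sq_eq_enorm_integral_mul_conj {ν : Measure Y} {F : Y → 𝕜}
    (hF : MemLp F 2 ν) :
    ∫⁻ y, ‖F y‖ₑ ^ 2 ∂ν = ‖∫ y, F y * (starRingEnd 𝕜) (F y) ∂ν‖ₑ := by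
  simp_rw [RCLike.mul_conj, ← RCLike.ofReal_pow]
  rw [enorm_integral_rclike_ofReal (hF.integrable_norm_pow two_ne_zero) fun y => by positivity]
  simp_rw [ENNReal.ofReal_pow (norm_nonneg _), ofReal_norm]

lemma eLpNorm_ofReal_rpow {ε : Type*} [ENorm ε] {μ : Measure X} {F : X → ε} {p : ℝ}
    (hp : 0 < p) :
    eLpNorm F (ENNReal.ofReal p) μ ^ p = ∫⁻ x, ‖F x‖ₑ ^ p ∂μ := by
  rw [eLpNorm_eq_lintegral_rpow_enorm_toReal (by simpa using hp) ENNReal.ofReal_ne_top,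
    ENNReal.toReal_ofReal hp.le, one_div, ENNReal.rpow_inv_rpow hp.ne']

lemma enorm_integral_ofReal_norm_rpow {μ : Measure X} {F : X → 𝕜} {p : ℝ} (hp : 0 < p)
    (hF : MemLp F (ENNReal.ofReal p) μ) :
    ‖∫ x, ((‖F x‖ ^ p : ℝ) : 𝕜) ∂μ‖ₑ = eLpNorm F (ENNReal.ofReal p) μ ^ p := by
  have hint : Integrable (fun x => ‖F x‖ ^ p) μ := by
    simpa only [ENNReal.toReal_ofReal hp.le] using
      hF.integrable_norm_rpow (by simpa using hp) ENNReal.ofReal_ne_top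
  rw [enorm_integral_rclike_ofReal hint fun x => by positivity, eLpNorm_ofReal_rpow hp]
  simp_rw [← ENNReal.ofReal_rpow_of_nonneg (norm_nonneg _) hp.le, ofReal_norm]

lemma enorm_integral_mul_le_eLpNorm_mul_eLpNorm {ν : Measure Y} {F G : Y → 𝕜}
    (hF : AEStronglyMeasurable F ν) (hG : AEStronglyMeasurable G ν) :
    ‖∫ y, F y * G y ∂ν‖ₑ ≤ eLpNorm F 2 ν * eLpNorm G 2 ν :=
  calc ‖∫ y, F y * G y ∂ν‖ₑ ≤ eLpNorm (F • G) 1 ν := by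
        rw [eLpNorm_one_eq_lintegral_enorm]
        exact enorm_integral_le_lintegral_enorm _
    _ ≤ _ := eLpNorm_smul_le_mul_eLpNorm hG hF

lemma exists_dual_function {F : X → 𝕜} (hF : Measurable F) {p M : ℝ} (hp : 1 < p)
    (hM : ∀ x, ‖F x‖ ≤ M) :
    ∃ h : X → 𝕜, Measurable h ∧ (∀ x, ‖h x‖ ≤ M ^ (p - 1)) ∧
      (∀ x, ‖h x‖ = ‖F x‖ ^ (p - 1)) ∧ ∀ x, h x * F x = ((‖F x‖ ^ p : ℝ) : 𝕜) := by
  have hnorm : ∀ x, ‖((‖F x‖ ^ (p - 2) : ℝ) : 𝕜) * (starRingEnd 𝕜) (F x)‖ =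
      ‖F x‖ ^ (p - 1) := fun x => by
    rw [norm_mul, RCLike.norm_conj, RCLike.norm_ofReal, abs_of_nonneg (by positivity),
      ← Real.rpow_add_one' (norm_nonneg _) (by linarith)]
    ring_nf
  refine ⟨fun x => ((‖F x‖ ^ (p - 2) : ℝ) : 𝕜) * (starRingEnd 𝕜) (F x), ?_, fun x => ?_, hnorm,
    fun x => ?_⟩
  · exact (RCLike.measurable_ofReal.comp (hF.norm.pow_const _)).mul
      (RCLike.continuous_conj.measurable.comp hF)
  · rw [hnorm]
    exact Real.rpow_le_rpow (norm_nonneg _) (hM x) (by linarith)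
  · rw [mul_assoc, RCLike.conj_mul, ← RCLike.ofReal_pow, ← RCLike.ofReal_mul,
      ← Real.rpow_add_natCast' (norm_nonneg _) (by push_cast; linarith)]
    norm_num

lemma le_of_rpow_le_mul_rpow_sub_one {n C : ℝ≥0∞} {p : ℝ} (hn : n ≠ ∞) (h0 : n ≠ 0)
    (h : n ^ p ≤ C * n ^ (p - 1)) : n ≤ C := by
  rw [show p = 1 + (p - 1) by ring, ENNReal.rpow_add _ _ h0 hn, ENNReal.rpow_one,
    add_sub_cancel_left] at h
  exact (ENNReal.mul_le_mul_iff_left (ENNReal.rpow_pos (pos_iff_ne_zero.mpr h0) hn).ne'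
    (ENNReal.rpow_ne_top_of_ne_zero h0 hn)).mp h

theorem eLpNorm_le_of_forall_enorm_integral_mul_le {μ : Measure X} [IsFiniteMeasure μ]
    {F : X → 𝕜} (hF : Measurable F) {p q M : ℝ} (hpq : p.HolderConjugate q)
    (hM : ∀ x, ‖F x‖ ≤ M) {C : ℝ≥0∞}
    (hC : ∀ h : X → 𝕜, Measurable h → (∃ N, ∀ x, ‖h x‖ ≤ N) →
      ‖∫ x, h x * F x ∂μ‖ₑ ≤ C * eLpNorm h (ENNReal.ofReal q) μ) :
    eLpNorm F (ENNReal.ofReal p) μ ≤ C := by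
  have hF' : MemLp F (ENNReal.ofReal p) μ :=
    MemLp.of_bound hF.aestronglyMeasurable M (ae_of_all _ hM)
  set n := eLpNorm F (ENNReal.ofReal p) μ
  rcases eq_or_ne n 0 with h0 | h0
  · exact h0.trans_le zero_le
  obtain ⟨h, hmeas, hbdd, hnorm, hmul⟩ := exists_dual_function hF hpq.lt hM
  have hdual : eLpNorm h (ENNReal.ofReal q) μ = n ^ (p - 1) := by
    have hpow : eLpNorm h (ENNReal.ofReal q) μ ^ q = n ^ p := by
      rw [eLpNorm_ofReal_rpow hpq.symm.pos, eLpNorm_ofReal_rpow hpq.pos]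
      refine lintegral_congr fun x => ?_
      rw [← ofReal_norm, hnorm,
        ← ENNReal.ofReal_rpow_of_nonneg (norm_nonneg _) hpq.sub_one_pos.le, ofReal_norm,
        ← ENNReal.rpow_mul, hpq.sub_one_mul_conj]
    rw [← ENNReal.rpow_rpow_inv hpq.symm.ne_zero (eLpNorm h _ μ), hpow, ← ENNReal.rpow_mul,
      ← div_eq_mul_inv, hpq.div_conj_eq_sub_one]
  have hle := hC h hmeas ⟨_, hbdd⟩
  simp_rw [hmul] at hle
  rw [enorm_integral_ofReal_norm_rpow hpq.pos hF', hdual] at hle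
  exact le_of_rpow_le_mul_rpow_sub_one hF'.eLpNorm_ne_top h0 hle

lemma measurable_integral_mul {ν : Measure Y} [SFinite ν] {E : X → Y → 𝕜}
    (hE : Measurable (Function.uncurry E)) {G : Y → 𝕜} (hG : AEStronglyMeasurable G ν) :
    Measurable fun x => ∫ y, E x y * G y ∂ν := by
  have hcongr : (fun x => ∫ y, E x y * G y ∂ν) = fun x => ∫ y, E x y * hG.mk G y ∂ν := by
    ext x
    exact integral_congr_ae (hG.ae_eq_mk.mono fun y hy => by simp only [hy])
  have hmk : Measurable fun z : X × Y => hG.mk G z.2 :=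
    hG.stronglyMeasurable_mk.measurable.comp measurable_snd
  rw [hcongr]
  exact (StronglyMeasurable.integral_prod_right (f := fun x y => E x y * hG.mk G y)
    (hE.mul hmk).stronglyMeasurable).measurable

lemma norm_integral_mul_le {ν : Measure Y} {D : Y → ℝ} {F G : Y → 𝕜} (hD : MemLp D 2 ν)
    (hF : ∀ y, ‖F y‖ ≤ D y) (hG : MemLp G 2 ν) :
    ‖∫ y, F y * G y ∂ν‖ ≤ ∫ y, D y * ‖G y‖ ∂ν := by
  refine norm_integral_le_of_norm_le (hD.integrable_mul hG.norm) (ae_of_all _ fun y => ?_)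
  rw [norm_mul]
  exact mul_le_mul_of_nonneg_right (hF y) (norm_nonneg _)

lemma enorm_integral_mul_mul_conj_mul {ν : Measure Y} (a b : 𝕜) (f g : Y → 𝕜) :
    ‖∫ y, a * f y * (starRingEnd 𝕜) (b * g y) ∂ν‖ₑ =
      ‖a‖ₑ * ‖b‖ₑ * ‖∫ y, f y * (starRingEnd 𝕜) (g y) ∂ν‖ₑ := by
  have hfactor : ∀ y, a * f y * (starRingEnd 𝕜) (b * g y) =
      a * (starRingEnd 𝕜) b * (f y * (starRingEnd 𝕜) (g y)) := fun y => by
    rw [map_mul]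
    ring
  simp_rw [hfactor]
  rw [integral_const_mul, enorm_mul, enorm_mul, ← ofReal_norm ((starRingEnd 𝕜) b),
    RCLike.norm_conj, ofReal_norm]

variable {μ : Measure X} [IsFiniteMeasure μ] {ν : Measure Y} {E : X → Y → 𝕜} {D : Y → ℝ}

lemma memLp_two_integral_left (hE : Measurable (Function.uncurry E)) (hD : MemLp D 2 ν)
    (hED : ∀ x y, ‖E x y‖ ≤ D y) : MemLp (fun y => ∫ x, E x y ∂μ) 2 ν := by
  have hmeas : StronglyMeasurable fun y => ∫ x, E x y ∂μ :=
    StronglyMeasurable.integral_prod_right (f := fun y x => E x y)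
      (hE.comp measurable_swap).stronglyMeasurable
  refine (hD.mul_const (μ.real Set.univ)).mono' hmeas.aestronglyMeasurable
    (ae_of_all _ fun y => ?_)
  exact norm_integral_le_of_norm_le_const (ae_of_all _ fun x => hED x y)

lemma integrable_mul_conj_prod (hE : Measurable (Function.uncurry E)) (hD : MemLp D 2 ν)
    (hED : ∀ x y, ‖E x y‖ ≤ D y) :
    Integrable (fun w : Y × X × X => E w.2.1 w.1 * (starRingEnd 𝕜) (E w.2.2 w.1))
      (ν.prod (μ.prod μ)) := by
  have hfst : Measurable fun w : Y × X × X => E w.2.1 w.1 :=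
    hE.comp (measurable_snd.fst.prodMk measurable_fst)
  have hsnd : Measurable fun w : Y × X × X => E w.2.2 w.1 :=
    hE.comp (measurable_snd.snd.prodMk measurable_fst)
  refine ((hD.integrable_sq).comp_fst (μ.prod μ)).mono'
    (hfst.mul (RCLike.continuous_conj.measurable.comp hsnd)).aestronglyMeasurable
    (ae_of_all _ fun w => ?_)
  rw [norm_mul, RCLike.norm_conj, sq]
  have := (norm_nonneg _).trans (hED w.2.1 w.1)
  gcongr <;> exact hED _ _

variable [SFinite ν]

lemma lintegral_enorm_integral_sq_le (hE : Measurable (Function.uncurry E)) (hD : MemLp D 2 ν)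
    (hED : ∀ x y, ‖E x y‖ ≤ D y) :
    ∫⁻ y, ‖∫ x, E x y ∂μ‖ₑ ^ 2 ∂ν ≤
      ∫⁻ z, ‖∫ y, E z.1 y * (starRingEnd 𝕜) (E z.2 y) ∂ν‖ₑ ∂(μ.prod μ) := by
  have hexpand : ∀ y, (∫ x, E x y ∂μ) * (starRingEnd 𝕜) (∫ x, E x y ∂μ) =
      ∫ z, E z.1 y * (starRingEnd 𝕜) (E z.2 y) ∂(μ.prod μ) := fun y => by
    rw [integral_prod_mul (fun x => E x y) (fun x => (starRingEnd 𝕜) (E x y)), integral_conj]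
  rw [lintegral_enorm_sq_eq_enorm_integral_mul_conj (memLp_two_integral_left hE hD hED)]
  simp_rw [hexpand]
  rw [integral_integral_swap (integrable_mul_conj_prod hE hD hED)]
  exact enorm_integral_le_lintegral_enorm _

lemma enorm_integral_integral_mul_le (hE : Measurable (Function.uncurry E)) (hD : MemLp D 2 ν)
    (hED : ∀ x y, ‖E x y‖ ≤ D y) {G : Y → 𝕜} (hG : MemLp G 2 ν) :
    ‖∫ x, ∫ y, E x y * G y ∂ν ∂μ‖ₑ ≤
      (∫⁻ z, ‖∫ y, E z.1 y * (starRingEnd 𝕜) (E z.2 y) ∂ν‖ₑ ∂(μ.prod μ)) ^ (1 / 2 : ℝ) *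
        eLpNorm G 2 ν := by
  have hint : Integrable (fun w : X × Y => E w.1 w.2 * G w.2) (μ.prod ν) := by
    refine ((hD.integrable_mul hG.norm).comp_snd μ).mono'
      (hE.aestronglyMeasurable.mul hG.1.comp_snd) (ae_of_all _ fun w => ?_)
    rw [norm_mul]
    exact mul_le_mul_of_nonneg_right (hED _ _) (norm_nonneg _)
  rw [integral_integral_swap hint]
  simp_rw [integral_mul_const]
  refine (enorm_integral_mul_le_eLpNorm_mul_eLpNorm
    (memLp_two_integral_left hE hD hED).1 hG.1).trans ?_
  gcongr
  rw [eLpNorm_eq_lintegral_rpow_enorm_toReal two_ne_zero ENNReal.ofNat_ne_top]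
  simp only [ENNReal.toReal_ofNat, ENNReal.rpow_ofNat]
  gcongr
  exact lintegral_enorm_integral_sq_le hE hD hED

theorem eLpNorm_integral_mul_le_of_kernel {m : ℝ} (hm : 1 ≤ m)
    (hE : Measurable (Function.uncurry E)) (hD : MemLp D 2 ν) (hED : ∀ x y, ‖E x y‖ ≤ D y)
    {G : Y → 𝕜} (hG : MemLp G 2 ν) {k : X × X → ℝ≥0∞} (hk : Measurable k)
    (hEk : ∀ᵐ z ∂(μ.prod μ), ‖∫ y, E z.1 y * (starRingEnd 𝕜) (E z.2 y) ∂ν‖ₑ ≤ k z) {A : ℝ≥0∞}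
    (hA₁ : ∀ᵐ x ∂μ, ∫⁻ y, k (x, y) ^ m ∂μ ≤ A) (hA₂ : ∀ᵐ y ∂μ, ∫⁻ x, k (x, y) ^ m ∂μ ≤ A) :
    eLpNorm (fun x => ∫ y, E x y * G y ∂ν) (ENNReal.ofReal (2 * m)) μ ≤
      A ^ (1 / (2 * m)) * eLpNorm G 2 ν := by
  set q := (2 * m).conjExponent
  have hq : (2 * m).HolderConjugate q := Real.HolderConjugate.conjExponent (by linarith)
  have hqm : q⁻¹ + q⁻¹ + m⁻¹ = 2 := by
    have := hq.inv_add_inv_eq_one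
    rw [mul_inv] at this
    linarith
  refine eLpNorm_le_of_forall_enorm_integral_mul_le (measurable_integral_mul hE hG.1) hq
    (fun x => norm_integral_mul_le hD (hED x) hG) fun h hh ⟨N, hN⟩ => ?_
  have hhE : ∀ x y, ‖h x * E x y‖ ≤ N * D y := fun x y => by
    rw [norm_mul]
    exact mul_le_mul (hN x) (hED x y) (norm_nonneg _) ((norm_nonneg _).trans (hN x))
  have hyoung := lintegral_prod_mul_mul_le hq.symm.lt.le hq.symm.lt.le hm hqm hh.enorm hh.enorm hk
    hA₁ hA₂
  rw [hq.symm.one_sub_inv, ← eLpNorm_ofReal_rpow hq.symm.pos,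
    ENNReal.rpow_rpow_inv hq.symm.ne_zero] at hyoung
  set n := eLpNorm h (ENNReal.ofReal q) μ
  calc ‖∫ x, h x * ∫ y, E x y * G y ∂ν ∂μ‖ₑ
      = ‖∫ x, ∫ y, h x * E x y * G y ∂ν ∂μ‖ₑ := by simp_rw [mul_assoc, integral_const_mul]
    _ ≤ (∫⁻ z, ‖h z.1‖ₑ * ‖h z.2‖ₑ *
          ‖∫ y, E z.1 y * (starRingEnd 𝕜) (E z.2 y) ∂ν‖ₑ ∂(μ.prod μ)) ^ (1 / 2 : ℝ) *
          eLpNorm G 2 ν := by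
        simpa only [enorm_integral_mul_mul_conj_mul] using enorm_integral_integral_mul_le (μ := μ)
          (E := fun x y => h x * E x y) ((hh.comp measurable_fst).mul hE) (hD.const_mul N) hhE hG
    _ ≤ (n * n * A ^ (2 * m)⁻¹ * A ^ (2 * m)⁻¹) ^ (1 / 2 : ℝ) * eLpNorm G 2 ν := by
        gcongr
        refine (lintegral_mono_ae (hEk.mono fun z hz => ?_)).trans hyoung
        gcongr
    _ = A ^ (1 / (2 * m)) * eLpNorm G 2 ν * n := by
        rw [show n * n * A ^ (2 * m)⁻¹ * A ^ (2 * m)⁻¹ = (A ^ (2 * m)⁻¹ * n) ^ (2 : ℝ) by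
          rw [ENNReal.rpow_two]; ring, ← ENNReal.rpow_mul]
        norm_num
        ring

end Kernels
section SingularKernel

variable {V : Type*} [NormedAddCommGroup V] [MeasurableSpace V] [BorelSpace V] (ν : Measure V)

lemma lintegral_ball_enorm_rpow_neg_lt_top [NormedSpace ℝ V] [FiniteDimensional ℝ V]
    [Nontrivial V] [ν.IsAddHaarMeasure] {e : ℝ} (he : e < Module.finrank ℝ V) (ρ : ℝ) :
    ∫⁻ u in Metric.ball (0 : V) ρ, ‖u‖ₑ ^ (-e) ∂ν < ∞ := by
  have hint : IntegrableOn (fun u : V => ‖u‖ ^ (-e)) (Metric.ball 0 ρ) ν := by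
    refine integrableOn_ball_of_norm_le_rpow (C := 1) Module.finrank_pos he
      (ae_of_all _ fun u => ?_) (measurable_norm.pow_const _).aestronglyMeasurable
    rw [one_mul, Real.norm_of_nonneg (by positivity)]
  refine lt_of_eq_of_lt (lintegral_congr_ae (ae_restrict_of_ae ?_)) hint.hasFiniteIntegral
  have hne : ∀ᵐ u ∂ν, u ≠ 0 := by simp [ae_iff]
  filter_upwards [hne] with u hu
  rw [← ofReal_norm, ENNReal.ofReal_rpow_of_pos (norm_pos_iff.mpr hu),
    Real.enorm_of_nonneg (by positivity)]

lemma setLIntegral_ball_comp_sub_left_le [ν.IsAddLeftInvariant] [ν.IsNegInvariant]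
    (f : V → ℝ≥0∞) {x₀ x : V} {r : ℝ} (hx : x ∈ Metric.ball x₀ r) :
    ∫⁻ y in Metric.ball x₀ r, f (x - y) ∂ν ≤ ∫⁻ u in Metric.ball 0 (2 * r), f u ∂ν := by
  have hsub : Metric.ball x₀ r ⊆ (x - ·) ⁻¹' Metric.ball 0 (2 * r) := fun y hy => by
    rw [Set.mem_preimage, mem_ball_zero_iff, ← dist_eq_norm, two_mul]
    exact (dist_triangle_right x y x₀).trans_lt (add_lt_add hx hy)
  calc ∫⁻ y in Metric.ball x₀ r, f (x - y) ∂ν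
      ≤ ∫⁻ y in (x - ·) ⁻¹' Metric.ball 0 (2 * r), f (x - y) ∂ν := lintegral_mono_set hsub
    _ = ∫⁻ u in Metric.ball 0 (2 * r), f u ∂ν :=
      (Measure.measurePreserving_sub_left ν x).setLIntegral_comp_preimage_emb
        (MeasurableEquiv.subLeft x).measurableEmbedding f _

end SingularKernel

section Linearization

variable {X : Type*} [MeasurableSpace X] {μ : Measure X}

lemma exists_measurable_argmax {Z : Type*} [LinearOrder Z] [TopologicalSpace Z]
    [OrderClosedTopology Z] [SecondCountableTopology Z] [MeasurableSpace Z]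
    [OpensMeasurableSpace Z] {F : ℕ → X → Z} (hF : ∀ n, Measurable (F n)) (n : ℕ) :
    ∃ ι : X → ℕ, Measurable ι ∧ ∀ x, ι x ≤ n ∧ ∀ j ≤ n, F j x ≤ F (ι x) x := by
  classical
  have hex : ∀ x, ∃ i ≤ n, ∀ j ≤ n, F j x ≤ F i x := fun x => by
    obtain ⟨i, hi, hmax⟩ := (Finset.Iic n).exists_max_image (F · x) Finset.nonempty_Iic
    exact ⟨i, Finset.mem_Iic.mp hi, fun j hj => hmax j (Finset.mem_Iic.mpr hj)⟩
  refine ⟨fun x => Nat.find (hex x), measurable_find hex fun i => ?_,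
    fun x => Nat.find_spec (hex x)⟩
  simp only [Set.ofPred_and, Set.ofPred_forall]
  exact (MeasurableSet.const _).inter <| MeasurableSet.iInter fun j =>
    MeasurableSet.iInter fun _ => measurableSet_le (hF j) (hF i)

lemma eLpNorm_iSup_of_monotone {F : ℕ → X → ℝ≥0∞} (hF : ∀ n, Measurable (F n))
    (hmono : Monotone F) {p : ℝ} (hp : 0 < p) :
    eLpNorm (fun x => ⨆ n, F n x) (ENNReal.ofReal p) μ =
      ⨆ n, eLpNorm (F n) (ENNReal.ofReal p) μ := by
  refine ENNReal.rpow_left_injective hp.ne' ?_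
  have hsup (a : ℕ → ℝ≥0∞) : (⨆ n, a n) ^ p = ⨆ n, a n ^ p :=
    (ENNReal.orderIsoRpow p hp).map_iSup a
  simp only [eLpNorm_ofReal_rpow hp, enorm_eq_self, hsup]
  exact lintegral_iSup (fun n => (hF n).pow_const _)
    fun i j hij x => ENNReal.rpow_le_rpow (hmono hij x) hp.le

theorem eLpNorm_iSup_le_of_forall_measurable_selection {F : ℕ → X → ℝ≥0∞}
    (hF : ∀ n, Measurable (F n)) {p : ℝ} (hp : 0 < p) {C : ℝ≥0∞}
    (hC : ∀ ι : X → ℕ, Measurable ι → (∃ n, ∀ x, ι x ≤ n) →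
      eLpNorm (fun x => F (ι x) x) (ENNReal.ofReal p) μ ≤ C) :
    eLpNorm (fun x => ⨆ n, F n x) (ENNReal.ofReal p) μ ≤ C := by
  have hmono : Monotone fun n x => ⨆ j ≤ n, F j x :=
    fun m n hmn x => biSup_mono fun j hj => hj.trans hmn
  simp_rw [← biSup_le_eq_iSup (f := fun n => F n _)]
  rw [eLpNorm_iSup_of_monotone (fun n => .iSup fun j => .iSup fun _ => hF j) hmono hp]
  refine iSup_le fun n => ?_
  obtain ⟨ι, hι, hmax⟩ := exists_measurable_argmax hF n
  refine (eLpNorm_mono_enorm fun x => ?_).trans (hC ι hι ⟨n, fun x => (hmax x).1⟩)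
  exact iSup₂_le (hmax x).2

end Linearization

/-- The truncated integral `∫_{-R}^{R} e^{i(aξ + tξ²)} g(ξ) dξ`. -/
def truncIntegral (g : ℝ → ℂ) (a t R : ℝ) : ℂ := ∫ ξ in (-R)..R, chirp a t ξ * g ξ

lemma continuous_truncIntegral {g : ℝ → ℂ} (hg : LocallyIntegrable g volume) :
    Continuous fun q : (ℝ × ℝ) × ℝ => truncIntegral g q.1.1 q.1.2 q.2 := by
  have hint (c d : ℝ) : IntervalIntegrable g volume c d :=
    (hg.integrableOn_isCompact isCompact_uIcc).intervalIntegrable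
  have hchirp (q : ℝ × ℝ) (c d : ℝ) :
      IntervalIntegrable (fun ξ => chirp q.1 q.2 ξ * g ξ) volume c d :=
    (hint c d).continuousOn_mul (continuous_chirp_right q.1 q.2).continuousOn
  have hprim : Continuous fun q : (ℝ × ℝ) × ℝ =>
      ∫ ξ in (0 : ℝ)..q.2, chirp q.1.1 q.1.2 ξ * g ξ := by
    rw [continuous_iff_continuousAt]
    rintro ⟨q, b⟩
    have hb := abs_nonneg b
    refine intervalIntegral.continuousAt_parametric_primitive_of_dominated
      (F := fun (q : ℝ × ℝ) ξ => chirp q.1 q.2 ξ * g ξ) (fun ξ => ‖g ξ‖) (-(|b| + 1)) (|b| + 1)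
      (fun q => (hchirp q _ _).def'.aestronglyMeasurable) (Eventually.of_forall fun q =>
        ae_of_all _ fun ξ => by rw [norm_mul, norm_chirp, one_mul]) (hint _ _).norm
      (ae_of_all _ fun ξ => Continuous.continuousAt ?_) ⟨by linarith, by linarith⟩
      ⟨by linarith [neg_abs_le b], by linarith [le_abs_self b]⟩ (measure_singleton b)
    exact (continuous_chirp.comp (by fun_prop : Continuous fun q : ℝ × ℝ => (q.1, q.2, ξ))).mul
      continuous_const
  refine (hprim.sub (hprim.comp (continuous_fst.prodMk continuous_snd.neg))).congr fun q => ?_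
  exact intervalIntegral.integral_interval_sub_left (hchirp _ _ _) (hchirp _ _ _)

/-- The function `(1 + ξ²)^{s/2} g(ξ)`, whose `L²` norm is the `H^s` norm when `g = f̂`. -/
def sobolevWeight (s : ℝ) (g : ℝ → ℂ) (ξ : ℝ) : ℂ := (((1 + ξ ^ 2) ^ (s / 2) : ℝ) : ℂ) * g ξ

lemma one_add_sq_rpow_neg_smul_sobolevWeight (s : ℝ) (g : ℝ → ℂ) (ξ : ℝ) :
    (1 + ξ ^ 2) ^ (-(s / 2)) • sobolevWeight s g ξ = g ξ := by
  rw [sobolevWeight, ← Complex.real_smul, smul_smul, ← Real.rpow_add (by positivity),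
    neg_add_cancel, Real.rpow_zero, one_smul]

lemma one_add_sq_rpow_neg_le_one {e : ℝ} (he : 0 ≤ e) (ξ : ℝ) : (1 + ξ ^ 2) ^ (-e) ≤ 1 :=
  Real.rpow_le_one_of_one_le_of_nonpos (by nlinarith [sq_nonneg ξ]) (by linarith)

lemma memLp_of_memLp_sobolevWeight {s : ℝ} (hs : 0 ≤ s) {g : ℝ → ℂ} {q : ℝ≥0∞}
    (hg : MemLp (sobolevWeight s g) q volume) : MemLp g q volume := by
  have hg' : g = fun ξ => (1 + ξ ^ 2) ^ (-(s / 2)) • sobolevWeight s g ξ :=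
    funext fun ξ => (one_add_sq_rpow_neg_smul_sobolevWeight s g ξ).symm
  have hmeas : AEStronglyMeasurable g volume := by
    rw [hg']
    exact (continuous_one_add_sq_rpow _).aestronglyMeasurable.smul hg.1
  refine hg.mono hmeas (ae_of_all _ fun ξ => ?_)
  rw [← one_add_sq_rpow_neg_smul_sobolevWeight s g ξ, norm_smul,
    Real.norm_of_nonneg (by positivity)]
  exact mul_le_of_le_one_left (norm_nonneg _) (one_add_sq_rpow_neg_le_one (by linarith) ξ)

/-- The kernel with which `sobolevWeight s g` is integrated to give `truncIntegral g a t R`. -/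
def truncKernel (s a t R : ℝ) : ℝ → ℂ :=
  (Set.Ioc (-R) R).indicator fun ξ => (1 + ξ ^ 2) ^ (-(s / 2)) • chirp a t ξ

lemma measurable_truncKernel (s : ℝ) :
    Measurable fun q : (ℝ × ℝ × ℝ) × ℝ => truncKernel s q.1.1 q.1.2.1 q.1.2.2 q.2 := by
  have hset : MeasurableSet {q : (ℝ × ℝ × ℝ) × ℝ | q.2 ∈ Set.Ioc (-q.1.2.2) q.1.2.2} :=
    (measurableSet_lt measurable_fst.snd.snd.neg measurable_snd).inter
      (measurableSet_le measurable_snd measurable_fst.snd.snd)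
  have hfun : Measurable fun q : (ℝ × ℝ × ℝ) × ℝ =>
      (1 + q.2 ^ 2) ^ (-(s / 2)) • chirp q.1.1 q.1.2.1 q.2 :=
    ((continuous_one_add_sq_rpow _).comp continuous_snd).measurable.smul
      (continuous_chirp.comp (by fun_prop : Continuous fun q : (ℝ × ℝ × ℝ) × ℝ =>
        (q.1.1, q.1.2.1, q.2))).measurable
  exact hfun.indicator hset

lemma norm_truncKernel_le {s R P : ℝ} (hs : 0 ≤ s) (hR : R ≤ P) (a t ξ : ℝ) :
    ‖truncKernel s a t R ξ‖ ≤ (Set.Icc (-P) P).indicator 1 ξ := by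
  rw [truncKernel, norm_indicator_eq_indicator_norm]
  refine (Set.indicator_le_indicator_of_subset (s := Set.Ioc (-R) R) (t := Set.Icc (-P) P)
    (fun ξ hξ => ⟨by linarith [hξ.1], hξ.2.trans hR⟩) (fun ξ => norm_nonneg _) ξ).trans
    (Set.indicator_le_indicator ?_)
  rw [norm_smul, norm_chirp, mul_one, Real.norm_of_nonneg (by positivity)]
  exact one_add_sq_rpow_neg_le_one (by linarith) ξ

lemma integral_indicator_Ioc_neg {E : Type*} [NormedAddCommGroup E] [NormedSpace ℝ E] {R : ℝ}
    (hR : 0 ≤ R) (f : ℝ → E) :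
    ∫ ξ, (Set.Ioc (-R) R).indicator f ξ = ∫ ξ in (-R)..R, f ξ := by
  rw [integral_indicator measurableSet_Ioc, intervalIntegral.integral_of_le (by linarith)]

lemma integral_truncKernel_mul_sobolevWeight {R : ℝ} (hR : 0 ≤ R) (s a t : ℝ) (g : ℝ → ℂ) :
    ∫ ξ, truncKernel s a t R ξ * sobolevWeight s g ξ = truncIntegral g a t R := by
  rw [truncIntegral, ← integral_indicator_Ioc_neg hR]
  congr 1 with ξ
  rw [truncKernel, ← Set.indicator_mul_left]
  congr 1 with ξ
  rw [smul_mul_assoc, ← mul_smul_comm, one_add_sq_rpow_neg_smul_sobolevWeight]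

lemma integral_truncKernel_mul_conj {R R' : ℝ} (hR : 0 ≤ R) (hR' : 0 ≤ R') (s a t a' t' : ℝ) :
    ∫ ξ, truncKernel s a t R ξ * (starRingEnd ℂ) (truncKernel s a' t' R' ξ) =
      ∫ ξ in (-min R R')..(min R R'), (1 + ξ ^ 2) ^ (-s) • chirp (a - a') (t - t') ξ := by
  rw [← integral_indicator_Ioc_neg (le_min hR hR')]
  congr 1 with ξ
  have hinter : Set.Ioc (-min R R') (min R R') = Set.Ioc (-R) R ∩ Set.Ioc (-R') R' := by
    rw [Set.Ioc_inter_Ioc, max_neg_neg]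
  have hconj (f : ℝ → ℂ) (S : Set ℝ) :
      (starRingEnd ℂ) (S.indicator f ξ) = S.indicator (fun ξ => (starRingEnd ℂ) (f ξ)) ξ :=
    congrFun (Set.indicator_comp_of_zero (map_zero _)).symm ξ
  have hweight (ξ : ℝ) : (1 + ξ ^ 2) ^ (-(s / 2)) * (1 + ξ ^ 2) ^ (-(s / 2)) =
      (1 + ξ ^ 2) ^ (-s) := by
    rw [← Real.rpow_add (by positivity)]
    ring_nf
  rw [hinter, truncKernel, truncKernel, hconj, ← Set.inter_indicator_mul]
  congr 1 with ξ
  rw [← chirp_mul_conj, ← hweight, ← smul_mul_smul_comm]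
  simp only [Complex.real_smul, map_mul, Complex.conj_ofReal]

section MaximalBound

variable {α C₁ C₂ β s m : ℝ}

lemma exists_enorm_integral_truncKernel_mul_conj_le (hα : 0 < α) (hC₁ : 0 < C₁) (hC₂ : 0 < C₂)
    (hβ : 0 < β) (hs₀ : 1 / 4 < s) (hs₁ : 1 - β < 2 * s) (hs₂ : 1 - 2 * α * β < 2 * s) (L : ℝ) :
    ∃ K : ℝ≥0, ∀ u a t R a' t' R' : ℝ, 0 ≤ R → 0 ≤ R' → |u| ≤ L →
      C₁⁻¹ * |u| ≤ |a - a'| + C₂ * |t - t'| ^ α →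
      ‖∫ ξ, truncKernel s a t R ξ * (starRingEnd ℂ) (truncKernel s a' t' R' ξ)‖ₑ ≤
        K * ‖u‖ₑ ^ (-β) := by
  obtain ⟨K, hK⟩ :=
    exists_norm_integral_one_add_sq_rpow_smul_chirp_le hα hC₁ hC₂ hβ hs₀ hs₁ hs₂ L
  refine ⟨(max K 1).toNNReal, fun u a t R a' t' R' hR hR' huL hsep => ?_⟩
  have hK₀ : 0 < max K 1 := lt_max_of_lt_right one_pos
  rcases eq_or_ne u 0 with rfl | hu
  · rw [enorm_zero, ENNReal.zero_rpow_of_neg (by linarith),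
      ENNReal.mul_top (by exact_mod_cast (Real.toNNReal_pos.mpr hK₀).ne')]
    exact le_top
  have hu : 0 < |u| := abs_pos.mpr hu
  rw [integral_truncKernel_mul_conj hR hR']
  calc _ ≤ ENNReal.ofReal (max K 1 * |u| ^ (-β)) := by
        rw [← ofReal_norm]
        refine ENNReal.ofReal_le_ofReal ((hK _ _ _ _ hu huL (le_min hR hR') hsep).trans ?_)
        gcongr
        exact le_max_left K 1
    _ = _ := by
        rw [ENNReal.ofReal_mul hK₀.le, ← ENNReal.ofReal_rpow_of_pos hu, ← Real.norm_eq_abs,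
          ofReal_norm, ENNReal.ofReal]

lemma lintegral_ball_const_mul_enorm_sub_rpow_neg_rpow_le (K : ℝ≥0∞) (hm : 0 ≤ m) {x₀ r x : ℝ}
    (hx : x ∈ Metric.ball x₀ r) :
    ∫⁻ y in Metric.ball x₀ r, (K * ‖x - y‖ₑ ^ (-β)) ^ m ≤
      K ^ m * ∫⁻ u in Metric.ball (0 : ℝ) (2 * r), ‖u‖ₑ ^ (-(β * m)) := by
  simp_rw [ENNReal.mul_rpow_of_nonneg _ _ hm, ← ENNReal.rpow_mul, neg_mul]
  rw [lintegral_const_mul _ (by fun_prop)]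
  exact mul_le_mul' le_rfl
    (setLIntegral_ball_comp_sub_left_le volume (fun u => ‖u‖ₑ ^ (-(β * m))) hx)

theorem exists_eLpNorm_truncIntegral_le (hα : 0 < α) (hC₁ : 0 < C₁) (hC₂ : 0 < C₂) (hβ : 0 < β)
    (hs₀ : 1 / 4 < s) (hs₁ : 1 - β < 2 * s) (hs₂ : 1 - 2 * α * β < 2 * s) (hm : 1 ≤ m)
    (hβm : β * m < 1) (x₀ r : ℝ) :
    ∃ C : ℝ≥0, ∀ a t R : ℝ → ℝ, Measurable a → Measurable t → Measurable R →
      (∀ x, 0 ≤ R x) → (∃ P, ∀ x, R x ≤ P) →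
      (∀ x ∈ Metric.ball x₀ r, ∀ y ∈ Metric.ball x₀ r,
        C₁⁻¹ * |x - y| ≤ |a x - a y| + C₂ * |t x - t y| ^ α) →
      ∀ g : ℝ → ℂ, MemLp (sobolevWeight s g) 2 volume →
        eLpNorm (fun x => truncIntegral g (a x) (t x) (R x)) (ENNReal.ofReal (2 * m))
          (volume.restrict (Metric.ball x₀ r)) ≤ C * eLpNorm (sobolevWeight s g) 2 volume := by
  obtain ⟨K, hK⟩ :=
    exists_enorm_integral_truncKernel_mul_conj_le hα hC₁ hC₂ hβ hs₀ hs₁ hs₂ (2 * r)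
  set A : ℝ≥0∞ := K ^ m * ∫⁻ u in Metric.ball (0 : ℝ) (2 * r), ‖u‖ₑ ^ (-(β * m))
  have hA : A ^ (1 / (2 * m)) ≠ ∞ := by
    refine ENNReal.rpow_ne_top_of_nonneg (by positivity) (ENNReal.mul_ne_top
      (ENNReal.rpow_ne_top_of_nonneg (by positivity) ENNReal.coe_ne_top) ?_)
    exact (lintegral_ball_enorm_rpow_neg_lt_top volume
      (by rwa [Module.finrank_self, Nat.cast_one]) _).ne
  refine ⟨(A ^ (1 / (2 * m))).toNNReal, fun a t R ha ht hR hR₀ ⟨P, hP⟩ hsep g hg => ?_⟩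
  set μ := (volume : Measure ℝ).restrict (Metric.ball x₀ r) with hμ
  have : IsFiniteMeasure μ := isFiniteMeasure_restrict.mpr measure_ball_lt_top.ne
  have hball : MeasurableSet (Metric.ball x₀ r) := Metric.isOpen_ball.measurableSet
  have hkernel : ∀ᵐ z ∂(μ.prod μ), ‖∫ ξ, truncKernel s (a z.1) (t z.1) (R z.1) ξ *
      (starRingEnd ℂ) (truncKernel s (a z.2) (t z.2) (R z.2) ξ)‖ₑ ≤ K * ‖z.1 - z.2‖ₑ ^ (-β) := by
    rw [hμ, Measure.prod_restrict]
    refine ae_restrict_of_forall_mem (hball.prod hball) ?_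
    rintro ⟨x, y⟩ ⟨hx, hy⟩
    refine hK _ _ _ _ _ _ _ (hR₀ x) (hR₀ y) ?_ (hsep x hx y hy)
    rw [← Real.dist_eq, two_mul]
    exact (dist_triangle_right x y x₀).trans (add_le_add hx.le hy.le)
  have hA₁ : ∀ᵐ x ∂μ, ∫⁻ y, (K * ‖x - y‖ₑ ^ (-β)) ^ m ∂μ ≤ A :=
    ae_restrict_of_forall_mem hball fun x hx =>
      lintegral_ball_const_mul_enorm_sub_rpow_neg_rpow_le K (by positivity) hx
  have hE : Measurable (Function.uncurry fun x => truncKernel s (a x) (t x) (R x)) :=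
    (measurable_truncKernel s).comp (by fun_prop : Measurable fun q : ℝ × ℝ =>
      ((a q.1, t q.1, R q.1), q.2))
  have hD : MemLp ((Set.Icc (-P) P).indicator (1 : ℝ → ℝ)) 2 volume :=
    memLp_indicator_const 2 measurableSet_Icc 1 (Or.inr measure_Icc_lt_top.ne)
  rw [ENNReal.coe_toNNReal hA]
  simp_rw [← integral_truncKernel_mul_sobolevWeight (hR₀ _) s]
  exact eLpNorm_integral_mul_le_of_kernel hm hE hD
    (fun x => norm_truncKernel_le (by linarith) (hP x) _ _) hg (by fun_prop) hkernel hA₁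
    (by simpa only [enorm_sub_rev] using hA₁)

end MaximalBound

section SeparableSup

variable {T Z : Type*} [TopologicalSpace T] [TopologicalSpace.SeparableSpace T] [Nonempty T]
  [CompleteLinearOrder Z] [TopologicalSpace Z]

lemma iSup_denseSeq [ClosedIicTopology Z] {f : T → Z} (hf : Continuous f) :
    ⨆ n, f (TopologicalSpace.denseSeq T n) = ⨆ t, f t :=
  le_antisymm (iSup_comp_le _ _) <| iSup_le fun t =>
    (TopologicalSpace.denseRange_denseSeq T).induction_on
      (p := fun t => f t ≤ ⨆ n, f (TopologicalSpace.denseSeq T n)) t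
      (isClosed_Iic.preimage hf) fun n => le_iSup (fun n => f (TopologicalSpace.denseSeq T n)) n

lemma aemeasurable_iSup_of_continuous [OrderTopology Z] [SecondCountableTopology Z]
    [MeasurableSpace Z] [BorelSpace Z] {X : Type*} [MeasurableSpace X] {μ : Measure X}
    {F : X → T → Z} (hF : ∀ t, AEMeasurable (fun x => F x t) μ)
    (hcont : ∀ᵐ x ∂μ, Continuous (F x)) : AEMeasurable (fun x => ⨆ t, F x t) μ :=
  (AEMeasurable.iSup fun n => hF (TopologicalSpace.denseSeq T n)).congr
    (hcont.mono fun _ hx => iSup_denseSeq hx)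

end SeparableSup

section TruncMaximal

variable {X : Type*} {γ : X → ℝ → ℝ} {g : ℝ → ℂ}

lemma continuous_truncIntegral_of_continuousOn (hg : LocallyIntegrable g volume) {c : ℝ → ℝ}
    {I : Set ℝ} (hc : ContinuousOn c I) :
    Continuous fun q : I × ℝ => truncIntegral g (c q.1) q.1 q.2 :=
  (continuous_truncIntegral hg).comp
    (((hc.domRestrict.comp continuous_fst).prodMk
      (continuous_subtype_val.comp continuous_fst)).prodMk continuous_snd)

/-- The maximal function `sup_{0 < t < 1} sup_{R ≥ 0} |∫_{-R}^{R} e^{i(γ(x,t)ξ + tξ²)} g(ξ) dξ|`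
of the truncated integrals along a family of curves. -/
def truncMaximal (γ : X → ℝ → ℝ) (g : ℝ → ℂ) (x : X) : ℝ≥0∞ :=
  ⨆ q : Set.Ioo (0 : ℝ) 1 × Set.Ici (0 : ℝ), ‖truncIntegral g (γ x q.1) q.1 q.2‖ₑ

lemma truncMaximal_eq_iSup_denseSeq [Nonempty (Set.Ioo (0 : ℝ) 1)]
    (hg : LocallyIntegrable g volume) {x : X} (hx : ContinuousOn (γ x) (Set.Ioo 0 1)) :
    truncMaximal γ g x = ⨆ n,
      let q := TopologicalSpace.denseSeq (Set.Ioo (0 : ℝ) 1 × Set.Ici (0 : ℝ)) n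
      ‖truncIntegral g (γ x q.1) q.1 q.2‖ₑ :=
  (iSup_denseSeq ((continuous_truncIntegral_of_continuousOn hg hx).comp
    (continuous_fst.prodMk (continuous_subtype_val.comp continuous_snd))).enorm).symm

lemma enorm_truncIntegral_le_truncMaximal {t R : ℝ} (ht : t ∈ Set.Ioo (0 : ℝ) 1) (hR : 0 ≤ R)
    (γ : X → ℝ → ℝ) (g : ℝ → ℂ) (x : X) :
    ‖truncIntegral g (γ x t) t R‖ₑ ≤ truncMaximal γ g x :=
  le_iSup (fun q : Set.Ioo (0 : ℝ) 1 × Set.Ici (0 : ℝ) =>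
    ‖truncIntegral g (γ x q.1) q.1 q.2‖ₑ) (⟨t, ht⟩, ⟨R, hR⟩)

variable [MeasurableSpace X] {μ : Measure X}

/-- A Carathéodory family of curves on `(0, 1)`: measurable in the parameter `x`, continuous in
the time `t`, both up to a null set of parameters. -/
structure IsCaratheodory (γ : X → ℝ → ℝ) (μ : Measure X) : Prop where
  aemeasurable : ∀ t ∈ Set.Ioo (0 : ℝ) 1, AEMeasurable (fun x => γ x t) μ
  continuousOn : ∀ᵐ x ∂μ, ContinuousOn (γ x) (Set.Ioo 0 1)

namespace IsCaratheodory

lemma aemeasurable_truncIntegral (hγ : IsCaratheodory γ μ) (hg : LocallyIntegrable g volume)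
    {t : ℝ} (ht : t ∈ Set.Ioo (0 : ℝ) 1) (R : ℝ) :
    AEMeasurable (fun x => truncIntegral g (γ x t) t R) μ :=
  ((continuous_truncIntegral hg).comp (by fun_prop : Continuous fun a : ℝ =>
    ((a, t), R))).measurable.comp_aemeasurable (hγ.aemeasurable t ht)

lemma aemeasurable_truncMaximal (hγ : IsCaratheodory γ μ) (hg : LocallyIntegrable g volume) :
    AEMeasurable (truncMaximal γ g) μ := by
  have : Nonempty (Set.Ioo (0 : ℝ) 1) := (Set.nonempty_Ioo.mpr one_pos).to_subtype
  exact (AEMeasurable.iSup fun n => (hγ.aemeasurable_truncIntegral hg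
    (TopologicalSpace.denseSeq (Set.Ioo (0 : ℝ) 1 × Set.Ici (0 : ℝ)) n).1.2 _).enorm).congr
    (hγ.continuousOn.mono fun x hx => (truncMaximal_eq_iSup_denseSeq hg hx).symm)

end IsCaratheodory

end TruncMaximal

namespace IsTangentialCurve

variable {α C₁ C₂ x₀ r : ℝ} {γ : ℝ → ℝ → ℝ}

lemma continuousOn_left (hγ : IsTangentialCurve α C₁ C₂ x₀ r γ) (hC₁ : 0 ≤ C₁) {t : ℝ}
    (ht : t ∈ Set.Icc (0 : ℝ) 1) : ContinuousOn (fun x => γ x t) (Metric.ball x₀ r) :=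
  (LipschitzOnWith.of_dist_le_mul (K := ⟨C₁, hC₁⟩) fun x hx y hy =>
    hγ.upper x hx y hy t ht).continuousOn

lemma measurable_indicator_ball (hγ : IsTangentialCurve α C₁ C₂ x₀ r γ) (hC₁ : 0 ≤ C₁) {t : ℝ}
    (ht : t ∈ Set.Icc (0 : ℝ) 1) : Measurable ((Metric.ball x₀ r).indicator fun x => γ x t) := by
  classical
  rw [← Set.piecewise_eq_indicator]
  exact (hγ.continuousOn_left hC₁ ht).measurable_piecewise continuousOn_const
    Metric.isOpen_ball.measurableSet

lemma continuousOn_right (hγ : IsTangentialCurve α C₁ C₂ x₀ r γ) (hα : 0 < α) {x : ℝ}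
    (hx : x ∈ Metric.ball x₀ r) : ContinuousOn (γ x) (Set.Icc 0 1) := fun t ht => by
  have hlim : Tendsto (fun t' : ℝ => C₂ * |t' - t| ^ α) (𝓝[Set.Icc 0 1] t) (𝓝 0) := by
    have hc : Continuous fun t' : ℝ => C₂ * |t' - t| ^ α :=
      continuous_const.mul ((by fun_prop : Continuous fun t' : ℝ => |t' - t|).rpow_const
        fun _ => Or.inr hα.le)
    simpa only [sub_self, abs_zero, Real.zero_rpow hα.ne', mul_zero]
      using hc.continuousWithinAt.tendsto (x := t) (s := Set.Icc 0 1)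
  refine tendsto_iff_dist_tendsto_zero.mpr
    (squeeze_zero' (Eventually.of_forall fun _ => dist_nonneg) ?_ hlim)
  filter_upwards [self_mem_nhdsWithin] with t' ht'
  exact hγ.holder x hx t' ht' t ht

lemma isCaratheodory (hγ : IsTangentialCurve α C₁ C₂ x₀ r γ) (hα : 0 < α) (hC₁ : 0 ≤ C₁) :
    IsCaratheodory γ (volume.restrict (Metric.ball x₀ r)) where
  aemeasurable _ ht := (hγ.continuousOn_left hC₁ (Set.Ioo_subset_Icc_self ht)).aemeasurable
    Metric.isOpen_ball.measurableSet
  continuousOn := ae_restrict_of_forall_mem Metric.isOpen_ball.measurableSet fun _ hx =>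
    (hγ.continuousOn_right hα hx).mono Set.Ioo_subset_Icc_self

lemma separation (hγ : IsTangentialCurve α C₁ C₂ x₀ r γ) {x y t t' : ℝ}
    (hx : x ∈ Metric.ball x₀ r) (hy : y ∈ Metric.ball x₀ r) (ht : t ∈ Set.Icc (0 : ℝ) 1)
    (ht' : t' ∈ Set.Icc (0 : ℝ) 1) :
    C₁⁻¹ * |x - y| ≤ |γ x t - γ y t'| + C₂ * |t - t'| ^ α :=
  calc C₁⁻¹ * |x - y| ≤ |γ x t - γ y t| := hγ.lower x hx y hy t ht
    _ ≤ |γ x t - γ y t'| + |γ y t' - γ y t| := abs_sub_le _ _ _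
    _ ≤ |γ x t - γ y t'| + C₂ * |t - t'| ^ α := by
      rw [abs_sub_comm (γ y t')]
      gcongr
      exact hγ.holder y hy t ht t' ht'

end IsTangentialCurve

section TruncMaximalBound

variable {X : Type*} [MeasurableSpace X] {μ : Measure X} {γ : X → ℝ → ℝ} {s : ℝ} {C : ℝ≥0}

/-- The maximal estimate `‖sup_{t,R} |∫_{-R}^{R} e^{i(γ(x,t)ξ + tξ²)} g(ξ) dξ|‖_{L^q(μ)} ≤
C ‖(1 + ξ²)^{s/2} g‖_{L²}` for the truncated integrals along a family of curves. -/
def IsTruncMaximalBound (γ : X → ℝ → ℝ) (μ : Measure X) (s : ℝ) (q : ℝ≥0∞) (C : ℝ≥0) : Prop :=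
  ∀ g : ℝ → ℂ, MemLp (sobolevWeight s g) 2 volume →
    eLpNorm (truncMaximal γ g) q μ ≤ C * eLpNorm (sobolevWeight s g) 2 volume

lemma locallyIntegrable_of_memLp_sobolevWeight (hs : 0 ≤ s) {g : ℝ → ℂ} {q : ℝ≥0∞} (hq : 1 ≤ q)
    (hg : MemLp (sobolevWeight s g) q volume) : LocallyIntegrable g volume :=
  (memLp_of_memLp_sobolevWeight hs hg).locallyIntegrable hq

lemma IsTruncMaximalBound.mono_exponent [IsFiniteMeasure μ] (hγ : IsCaratheodory γ μ)
    (hs : 0 ≤ s) {p q : ℝ} (hp : 0 < p) (hpq : p ≤ q)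
    (h : IsTruncMaximalBound γ μ s (ENNReal.ofReal q) C) :
    IsTruncMaximalBound γ μ s (ENNReal.ofReal p)
      (C * measureUnivNNReal μ ^ (1 / p - 1 / q)) := by
  intro g hg
  have hmeas := hγ.aemeasurable_truncMaximal (locallyIntegrable_of_memLp_sobolevWeight hs
    one_le_two hg)
  have hexp : 0 ≤ 1 / p - 1 / q := sub_nonneg.mpr (one_div_le_one_div_of_le hp hpq)
  calc eLpNorm (truncMaximal γ g) (ENNReal.ofReal p) μ
      ≤ eLpNorm (truncMaximal γ g) (ENNReal.ofReal q) μ * μ Set.univ ^ (1 / p - 1 / q) := by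
        simpa only [ENNReal.toReal_ofReal hp.le, ENNReal.toReal_ofReal (hp.le.trans hpq)]
          using eLpNorm_le_eLpNorm_mul_rpow_measure_univ (ENNReal.ofReal_le_ofReal hpq)
            hmeas.aestronglyMeasurable
    _ ≤ C * eLpNorm (sobolevWeight s g) 2 volume * μ Set.univ ^ (1 / p - 1 / q) := by
        gcongr
        exact h g hg
    _ = _ := by
        rw [ENNReal.coe_mul, ENNReal.coe_rpow_of_nonneg _ hexp, coe_measureUnivNNReal,
          mul_right_comm]

lemma sobolevWeight_indicator (s : ℝ) (S : Set ℝ) (g : ℝ → ℂ) :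
    sobolevWeight s (S.indicator g) = S.indicator (sobolevWeight s g) :=
  funext fun _ =>
    (Set.indicator_mul_right S (fun ξ : ℝ => (((1 + ξ ^ 2) ^ (s / 2) : ℝ) : ℂ)) g).symm

lemma tendsto_eLpNorm_indicator_compl_of_aecover {ι E : Type*} [NormedAddCommGroup E]
    {l : Filter ι} [l.IsCountablyGenerated] {φ : ι → Set X} (hφ : AECover μ l φ) {q : ℝ≥0∞}
    (hq : q ≠ ∞) {f : X → E} (hf : MemLp f q μ) :
    Tendsto (fun i => eLpNorm ((φ i)ᶜ.indicator f) q μ) l (𝓝 0) := by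
  rcases eq_or_ne q 0 with rfl | hq₀
  · simpa only [eLpNorm_exponent_zero] using tendsto_const_nhds
  have hq' : 0 < q.toReal := ENNReal.toReal_pos hq₀ hq
  have hlim : Tendsto (fun i => ∫⁻ x, ‖(φ i)ᶜ.indicator f x‖ₑ ^ q.toReal ∂μ) l
      (𝓝 (∫⁻ _, 0 ∂μ)) := by
    refine tendsto_lintegral_filter_of_dominated_convergence' (fun x => ‖f x‖ₑ ^ q.toReal)
      (Eventually.of_forall fun i => ?_) (Eventually.of_forall fun i => ae_of_all _ fun x => ?_)
      (lintegral_rpow_enorm_lt_top_of_eLpNorm_lt_top hq₀ hq hf.2).ne ?_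
    · exact (hf.1.indicator (hφ.measurableSet i).compl).enorm.pow_const _
    · exact ENNReal.rpow_le_rpow (enorm_indicator_le_enorm_self _ _) hq'.le
    · filter_upwards [hφ.ae_eventually_mem] with x hx
      refine tendsto_const_nhds.congr' (hx.mono fun i hi => ?_)
      beta_reduce
      rw [Set.indicator_of_notMem (Set.notMem_compl_iff.mpr hi), enorm_zero,
        ENNReal.zero_rpow_of_pos hq']
  simp_rw [eLpNorm_eq_lintegral_rpow_enorm_toReal hq₀ hq]
  simpa only [lintegral_zero, ENNReal.zero_rpow_of_pos (one_div_pos.mpr hq')]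
    using hlim.ennrpow_const (1 / q.toReal)

lemma truncIntegral_indicator_compl_Ioc {g : ℝ → ℂ} (hg : LocallyIntegrable g volume) (a t : ℝ)
    {N R : ℝ} (hN : 0 ≤ N) (hNR : N ≤ R) :
    truncIntegral ((Set.Ioc (-N) N)ᶜ.indicator g) a t R =
      truncIntegral g a t R - truncIntegral g a t N := by
  have hint (R : ℝ) : Integrable ((Set.Ioc (-R) R).indicator fun ξ => chirp a t ξ * g ξ) := by
    rw [integrable_indicator_iff measurableSet_Ioc]
    exact ((hg.integrableOn_isCompact isCompact_Icc).continuousOn_mul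
      (continuous_chirp_right a t).continuousOn isCompact_Icc).mono_set Set.Ioc_subset_Icc_self
  simp only [truncIntegral]
  rw [← integral_indicator_Ioc_neg (hN.trans hNR), ← integral_indicator_Ioc_neg (hN.trans hNR),
    ← integral_indicator_Ioc_neg hN, ← integral_sub (hint R) (hint N)]
  congr 1 with ξ
  by_cases hξ : ξ ∈ Set.Ioc (-N) N
  · have hξR : ξ ∈ Set.Ioc (-R) R := ⟨by linarith [hξ.1], hξ.2.trans hNR⟩
    simp only [Set.indicator_of_mem hξ, Set.indicator_of_mem hξR,
      Set.indicator_of_notMem (Set.notMem_compl_iff.mpr hξ), mul_zero, sub_self]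
  · simp only [Set.indicator_of_notMem hξ, sub_zero, Set.indicator_of_mem (Set.mem_compl hξ),
      Set.indicator_apply (Set.Ioc (-R) R)]

lemma IsTruncMaximalBound.ae_iInf_truncMaximal_tail_eq_zero (hs : 0 ≤ s)
    (hγ : IsCaratheodory γ μ) {q : ℝ≥0∞} (hq : q ≠ 0) (h : IsTruncMaximalBound γ μ s q C)
    {g : ℝ → ℂ} (hg : MemLp (sobolevWeight s g) 2 volume) :
    ∀ᵐ x ∂μ, ⨅ N : ℕ, truncMaximal γ ((Set.Ioc (-(N : ℝ)) N)ᶜ.indicator g) x = 0 := by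
  have htail (N : ℕ) :
      MemLp (sobolevWeight s ((Set.Ioc (-(N : ℝ)) N)ᶜ.indicator g)) 2 volume := by
    rw [sobolevWeight_indicator]
    exact hg.indicator measurableSet_Ioc.compl
  have hmeas : AEMeasurable
      (fun x => ⨅ N : ℕ, truncMaximal γ ((Set.Ioc (-(N : ℝ)) N)ᶜ.indicator g) x) μ :=
    AEMeasurable.iInf fun N => hγ.aemeasurable_truncMaximal
      (locallyIntegrable_of_memLp_sobolevWeight hs one_le_two (htail N))
  refine (eLpNorm_eq_zero_iff hmeas.aestronglyMeasurable hq).mp (le_antisymm ?_ zero_le)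
  have hlim : Tendsto (fun N : ℕ =>
      C * eLpNorm (sobolevWeight s ((Set.Ioc (-(N : ℝ)) N)ᶜ.indicator g)) 2 volume)
      atTop (𝓝 (C * 0)) := by
    simp_rw [sobolevWeight_indicator]
    exact ENNReal.Tendsto.const_mul (tendsto_eLpNorm_indicator_compl_of_aecover
      (aecover_Ioc (tendsto_neg_atTop_atBot.comp tendsto_natCast_atTop_atTop)
        tendsto_natCast_atTop_atTop) ENNReal.ofNat_ne_top hg) (Or.inr ENNReal.coe_ne_top)
  rw [mul_zero] at hlim
  exact ge_of_tendsto' hlim fun N =>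
    (eLpNorm_mono_enorm fun x => iInf_le _ N).trans (h _ (htail N))

theorem IsTruncMaximalBound.ae_uniformCauchySeqOn_truncIntegral (hs : 0 ≤ s)
    (hγ : IsCaratheodory γ μ) {q : ℝ≥0∞} (hq : q ≠ 0) (h : IsTruncMaximalBound γ μ s q C)
    {g : ℝ → ℂ} (hg : MemLp (sobolevWeight s g) 2 volume) :
    ∀ᵐ x ∂μ, UniformCauchySeqOn (fun R t => truncIntegral g (γ x t) t R) atTop
      (Set.Ioo 0 1) := by
  have hloc := locallyIntegrable_of_memLp_sobolevWeight hs one_le_two hg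
  filter_upwards [h.ae_iInf_truncMaximal_tail_eq_zero hs hγ hq hg] with x hx
  refine Metric.uniformCauchySeqOn_iff.mpr fun ε hε => ?_
  obtain ⟨N, hN⟩ := iInf_lt_iff.mp (hx.trans_lt (ENNReal.ofReal_pos.mpr (half_pos hε)))
  have hdist {R t : ℝ} (hR : N ≤ R) (ht : t ∈ Set.Ioo (0 : ℝ) 1) :
      dist (truncIntegral g (γ x t) t R) (truncIntegral g (γ x t) t N) < ε / 2 := by
    rw [dist_eq_norm, ← truncIntegral_indicator_compl_Ioc hloc _ _ N.cast_nonneg hR,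
      ← ENNReal.ofReal_lt_ofReal_iff (half_pos hε), ofReal_norm]
    exact (enorm_truncIntegral_le_truncMaximal ht (N.cast_nonneg.trans hR) _ _ _).trans_lt hN
  refine ⟨N, fun R hR R' hR' t ht => ?_⟩
  exact (dist_triangle_right _ _ _).trans_lt
    ((add_lt_add (hdist hR ht) (hdist hR' ht)).trans_eq (add_halves ε))

end TruncMaximalBound

theorem exists_isTruncMaximalBound {α C₁ C₂ β s m : ℝ} (hα : 0 < α) (hC₁ : 0 < C₁)
    (hC₂ : 0 < C₂) (hβ : 0 < β) (hs₀ : 1 / 4 < s) (hs₁ : 1 - β < 2 * s)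
    (hs₂ : 1 - 2 * α * β < 2 * s) (hm : 1 ≤ m) (hβm : β * m < 1) (x₀ r : ℝ) :
    ∃ C : ℝ≥0, ∀ γ : ℝ → ℝ → ℝ, IsTangentialCurve α C₁ C₂ x₀ r γ →
      IsTruncMaximalBound γ (volume.restrict (Metric.ball x₀ r)) s (ENNReal.ofReal (2 * m)) C := by
  obtain ⟨C, hC⟩ := exists_eLpNorm_truncIntegral_le hα hC₁ hC₂ hβ hs₀ hs₁ hs₂ hm hβm x₀ r
  refine ⟨C, fun γ hγ g hg => ?_⟩
  have : Nonempty (Set.Ioo (0 : ℝ) 1) := (Set.nonempty_Ioo.mpr one_pos).to_subtype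
  have hloc := locallyIntegrable_of_memLp_sobolevWeight (by linarith) one_le_two hg
  set q := TopologicalSpace.denseSeq (Set.Ioo (0 : ℝ) 1 × Set.Ici (0 : ℝ))
  have hq_mem (n : ℕ) : ((q n).1 : ℝ) ∈ Set.Icc (0 : ℝ) 1 := Set.Ioo_subset_Icc_self (q n).1.2
  set γ' : ℕ → ℝ → ℝ := fun n => (Metric.ball x₀ r).indicator fun x => γ x (q n).1
  have hγ'_meas (n : ℕ) : Measurable (γ' n) := hγ.measurable_indicator_ball hC₁.le (hq_mem n)
  have hγ'_eq (n : ℕ) {x : ℝ} (hx : x ∈ Metric.ball x₀ r) : γ' n x = γ x (q n).1 :=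
    Set.indicator_of_mem hx _
  have hsup : truncMaximal γ g =ᵐ[volume.restrict (Metric.ball x₀ r)]
      fun x => ⨆ n, ‖truncIntegral g (γ' n x) (q n).1 (q n).2‖ₑ := by
    refine ae_restrict_of_forall_mem Metric.isOpen_ball.measurableSet fun x hx => ?_
    simp only [hγ'_eq _ hx]
    exact truncMaximal_eq_iSup_denseSeq hloc
      ((hγ.continuousOn_right hα hx).mono Set.Ioo_subset_Icc_self)
  rw [eLpNorm_congr_ae hsup]
  refine eLpNorm_iSup_le_of_forall_measurable_selection
    (fun n => ((continuous_truncIntegral hloc).measurable.comp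
      (((hγ'_meas n).prodMk measurable_const).prodMk measurable_const)).enorm) (by linarith)
    fun ι hι ⟨n, hn⟩ => ?_
  have hγ'ι_meas : Measurable fun x => γ' (ι x) x :=
    (measurable_from_prod_countable_right (f := fun z : ℕ × ℝ => γ' z.1 z.2) hγ'_meas).comp
      (hι.prodMk measurable_id)
  obtain ⟨P, hP⟩ := ((Set.finite_Iic n).image fun j => ((q j).2 : ℝ)).bddAbove
  rw [eLpNorm_enorm]
  refine hC (fun x => γ' (ι x) x) (fun x => (q (ι x)).1) (fun x => (q (ι x)).2) hγ'ι_meas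
    ((measurable_from_nat (f := fun j => ((q j).1 : ℝ))).comp hι)
    ((measurable_from_nat (f := fun j => ((q j).2 : ℝ))).comp hι) (fun x => (q (ι x)).2.2)
    ⟨P, fun x => hP (Set.mem_image_of_mem _ (hn x))⟩ (fun x hx y hy => ?_) g hg
  simp only [hγ'_eq _ hx, hγ'_eq _ hy]
  exact hγ.separation hx hy (hq_mem _) (hq_mem _)

section Schrodinger

variable {f : Lp ℂ 2 (volume : Measure ℝ)}

lemma schrodingerTrunc_eq_mul_truncIntegral (f : Lp ℂ 2 (volume : Measure ℝ)) (t x R : ℝ) :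
    schrodingerTrunc f t x R = (2 * Real.pi : ℂ)⁻¹ * truncIntegral (fhat f) x t R := rfl

lemma enorm_schrodingerTrunc_le (f : Lp ℂ 2 (volume : Measure ℝ)) (t x R : ℝ) :
    ‖schrodingerTrunc f t x R‖ₑ ≤ ‖truncIntegral (fhat f) x t R‖ₑ := by
  have hpi : ‖(2 * Real.pi : ℂ)⁻¹‖ ≤ 1 := by
    rw [norm_inv, norm_mul, Complex.norm_real, Complex.norm_ofNat,
      Real.norm_of_nonneg Real.pi_pos.le]
    exact inv_le_one_of_one_le₀ (by linarith [Real.pi_gt_three])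
  rw [schrodingerTrunc_eq_mul_truncIntegral, ← enorm_norm, ← enorm_norm (truncIntegral _ _ _ _),
    norm_mul, enorm_le_iff_norm_le, norm_mul, norm_norm, norm_norm]
  exact mul_le_of_le_one_left (norm_nonneg _) hpi

lemma tendstoUniformlyOn_schrodingerTrunc {c : ℝ → ℝ} {I : Set ℝ}
    (h : UniformCauchySeqOn (fun R t => truncIntegral (fhat f) (c t) t R) atTop I) :
    TendstoUniformlyOn (fun R t => schrodingerTrunc f t (c t) R)
      (fun t => schrodinger f t (c t)) atTop I := by
  have hcauchy : UniformCauchySeqOn (fun R t => schrodingerTrunc f t (c t) R) atTop I :=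
    (uniformContinuous_const_smul (2 * Real.pi : ℂ)⁻¹).comp_uniformCauchySeqOn h
  exact hcauchy.tendstoUniformlyOn_of_tendsto fun t ht => tendsto_nhds_limUnder
    (cauchy_map_iff_exists_tendsto.mp (hcauchy.cauchy_map ht))

lemma maximalFunction_le_truncMaximal {γ : ℝ → ℝ → ℝ} {x : ℝ}
    (h : ∀ t ∈ Set.Ioo (0 : ℝ) 1,
      Tendsto (schrodingerTrunc f t (γ x t)) atTop (𝓝 (schrodinger f t (γ x t)))) :
    maximalFunction γ f x ≤ truncMaximal γ (fhat f) x := by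
  refine iSup₂_le fun t ht => le_of_tendsto (h t ht).enorm ?_
  filter_upwards [eventually_ge_atTop 0] with R hR
  exact (enorm_schrodingerTrunc_le f t _ R).trans
    (enorm_truncIntegral_le_truncMaximal ht hR γ (fhat f) x)

lemma IsCaratheodory.aemeasurable_maximalFunction {μ : Measure ℝ} {γ : ℝ → ℝ → ℝ}
    (hγ : IsCaratheodory γ μ) (hf : LocallyIntegrable (fhat f) volume)
    (h : ∀ᵐ x ∂μ, TendstoUniformlyOn (fun R t => schrodingerTrunc f t (γ x t) R)
      (fun t => schrodinger f t (γ x t)) atTop (Set.Ioo 0 1)) :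
    AEMeasurable (maximalFunction γ f) μ := by
  have : Nonempty (Set.Ioo (0 : ℝ) 1) := (Set.nonempty_Ioo.mpr one_pos).to_subtype
  have hsup : maximalFunction γ f =
      fun x => ⨆ t : Set.Ioo (0 : ℝ) 1, ‖schrodinger f t (γ x t)‖ₑ :=
    funext fun x => iSup_subtype'
  rw [hsup]
  refine aemeasurable_iSup_of_continuous (fun t => ?_) ?_
  · refine (aemeasurable_of_tendsto_metrizable_ae (ι := ℕ) atTop
      (f := fun k x => schrodingerTrunc f t (γ x t) k)
      (fun k => (hγ.aemeasurable_truncIntegral hf t.2 k).const_mul _) ?_).enorm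
    exact h.mono fun x hx => (hx.tendsto_at t.2).comp tendsto_natCast_atTop_atTop
  · filter_upwards [h, hγ.continuousOn] with x hx hcont
    have htrunc (R : ℝ) : ContinuousOn (fun t => schrodingerTrunc f t (γ x t) R)
        (Set.Ioo 0 1) :=
      continuousOn_iff_continuous_domRestrict.mpr <| continuous_const.mul <|
        (continuous_truncIntegral_of_continuousOn hf hcont).comp (.prodMk_left R)
    exact (hx.continuousOn (Frequently.of_forall htrunc)).domRestrict.enorm

theorem IsTruncMaximalBound.maximalFunction {μ : Measure ℝ} {γ : ℝ → ℝ → ℝ} {s : ℝ} {C : ℝ≥0}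
    {q : ℝ≥0∞} (hs : 0 ≤ s) (hγ : IsCaratheodory γ μ) (hq : q ≠ 0)
    (h : IsTruncMaximalBound γ μ s q C) (hf : MemLp (sobolevWeight s (fhat f)) 2 volume) :
    (∀ᵐ x ∂μ, ∀ t ∈ Set.Ioo (0 : ℝ) 1,
      Tendsto (schrodingerTrunc f t (γ x t)) atTop (𝓝 (schrodinger f t (γ x t)))) ∧
    AEMeasurable (maximalFunction γ f) μ ∧
    eLpNorm (maximalFunction γ f) q μ ≤ C * normH s f := by
  have hunif : ∀ᵐ x ∂μ, TendstoUniformlyOn (fun R t => schrodingerTrunc f t (γ x t) R)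
      (fun t => schrodinger f t (γ x t)) atTop (Set.Ioo 0 1) :=
    (h.ae_uniformCauchySeqOn_truncIntegral hs hγ hq hf).mono fun x hx =>
      tendstoUniformlyOn_schrodingerTrunc hx
  have hconv : ∀ᵐ x ∂μ, ∀ t ∈ Set.Ioo (0 : ℝ) 1,
      Tendsto (schrodingerTrunc f t (γ x t)) atTop (𝓝 (schrodinger f t (γ x t))) :=
    hunif.mono fun x hx t ht => hx.tendsto_at ht
  refine ⟨hconv, hγ.aemeasurable_maximalFunction
    (locallyIntegrable_of_memLp_sobolevWeight hs one_le_two hf) hunif, ?_⟩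
  exact (eLpNorm_mono_enorm_ae (hconv.mono fun x hx =>
    maximalFunction_le_truncMaximal hx)).trans (h _ hf)

end Schrodinger

section SobolevSpace

lemma memLp_smul_of_smulLeftCLM_eq {E F : Type*} [NormedAddCommGroup E] [NormedSpace ℝ E]
    [FiniteDimensional ℝ E] [MeasurableSpace E] [BorelSpace E] {μ : Measure E}
    [μ.HasTemperateGrowth] [IsLocallyFiniteMeasure μ] [NormedAddCommGroup F] [NormedSpace ℂ F]
    [CompleteSpace F] {p : ℝ≥0∞} [Fact (1 ≤ p)] {w w' : E → ℂ} (hw : w.HasTemperateGrowth)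
    (hw' : w'.HasTemperateGrowth) (hbdd : MemLp w' ∞ μ) (hinv : ∀ x, w x * w' x = 1)
    {u v : Lp F p μ} (h : TemperedDistribution.smulLeftCLM F w (Lp.toTemperedDistribution u) =
      Lp.toTemperedDistribution v) :
    MemLp (fun x => w x • u x) p μ := by
  have hinj : Function.Injective (Lp.toTemperedDistributionCLM F μ p) :=
    LinearMap.ker_eq_bot.mp Lp.ker_toTemperedDistributionCLM_eq_bot
  have hsmul : (hbdd.toLp w' • v : Lp F p μ) = u := by
    apply hinj
    rw [Lp.toTemperedDistributionCLM_apply, Lp.toTemperedDistributionCLM_apply,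
      Lp.toTemperedDistribution_smul_eq hw', ← h,
      TemperedDistribution.smulLeftCLM_smulLeftCLM_apply hw hw',
      show w * w' = fun _ => 1 from funext hinv, TemperedDistribution.smulLeftCLM_const, one_smul]
  refine (Lp.memLp v).ae_eq ?_
  rw [← hsmul]
  filter_upwards [Lp.coeFn_lpSMul (r := p) (hbdd.toLp w') v, hbdd.coeFn_toLp] with x hx hx'
  rw [hx, Pi.smul_apply', hx', smul_smul, hinv, one_smul]

lemma memLp_sobolevWeight_fourier {s : ℝ} (hs : 0 ≤ s) {f : Lp ℂ 2 (volume : Measure ℝ)}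
    (hf : MemH s f) :
    MemLp (sobolevWeight s (𝓕 f : Lp ℂ 2 (volume : Measure ℝ))) 2 volume := by
  obtain ⟨v, hv⟩ := TemperedDistribution.memSobolev_iff_exists_smulLeftCLM_fourier.mp hf
  rw [Lp.fourier_toTemperedDistribution_eq] at hv
  have hbdd : MemLp (fun ξ : ℝ => (((1 + ‖ξ‖ ^ 2) ^ (-(s / 2)) : ℝ) : ℂ)) ∞ volume := by
    simp only [Real.norm_eq_abs, sq_abs]
    refine memLp_top_of_bound (Continuous.aestronglyMeasurable (by fun_prop)) 1
      (ae_of_all _ fun ξ => ?_)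
    rw [Complex.norm_real, Real.norm_of_nonneg (by positivity)]
    exact one_add_sq_rpow_neg_le_one (by linarith) ξ
  have hinv (ξ : ℝ) : (((1 + ‖ξ‖ ^ 2) ^ (s / 2) : ℝ) : ℂ) *
      (((1 + ‖ξ‖ ^ 2) ^ (-(s / 2)) : ℝ) : ℂ) = 1 := by
    rw [← Complex.ofReal_mul, ← Real.rpow_add (by positivity), add_neg_cancel, Real.rpow_zero,
      Complex.ofReal_one]
  have hmem := memLp_smul_of_smulLeftCLM_eq (by fun_prop) (by fun_prop) hbdd hinv hv
  simpa only [Real.norm_eq_abs, sq_abs, smul_eq_mul] using! hmem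

lemma memLp_comp_div {E : Type*} [NormedAddCommGroup E] {h : ℝ → E} {q : ℝ≥0∞}
    (hh : MemLp h q volume) {c : ℝ} (hc : c ≠ 0) : MemLp (fun ξ => h (ξ / c)) q volume := by
  simp only [div_eq_mul_inv]
  refine MemLp.comp_of_map ?_ (by fun_prop)
  rw [Real.map_volume_mul_right (inv_ne_zero hc)]
  exact hh.smul_measure ENNReal.ofReal_ne_top

lemma one_add_sq_rpow_le_rpow_mul {s c : ℝ} (hs : 0 ≤ s) (hc : 1 ≤ c) (ξ : ℝ) :
    (1 + ξ ^ 2) ^ (s / 2) ≤ c ^ s * (1 + (ξ / c) ^ 2) ^ (s / 2) := by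
  have hc₀ : 0 < c := by linarith
  have hpow : c ^ s = (c ^ 2) ^ (s / 2) := by
    rw [← Real.rpow_natCast_mul hc₀.le]
    congr 1
    push_cast
    ring
  rw [hpow, ← Real.mul_rpow (by positivity) (by positivity)]
  gcongr
  rw [div_pow, mul_add, mul_one, mul_div_cancel₀ _ (by positivity)]
  gcongr
  exact one_le_pow₀ hc

lemma memLp_sobolevWeight_comp_div {s c : ℝ} (hs : 0 ≤ s) (hc : 1 ≤ c) {g : ℝ → ℂ} {q : ℝ≥0∞}
    (hg : MemLp (sobolevWeight s g) q volume) :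
    MemLp (sobolevWeight s fun ξ => g (ξ / c)) q volume := by
  have hc₀ : c ≠ 0 := by linarith
  have hmeas : AEStronglyMeasurable (sobolevWeight s fun ξ => g (ξ / c)) volume :=
    (Continuous.aestronglyMeasurable (by fun_prop)).mul
      (memLp_comp_div (memLp_of_memLp_sobolevWeight hs hg) hc₀).1
  refine ((memLp_comp_div hg hc₀).const_mul ((c ^ s : ℝ) : ℂ)).mono hmeas
    (ae_of_all _ fun ξ => ?_)
  simp only [sobolevWeight, norm_mul, Complex.norm_real]
  rw [← mul_assoc]
  gcongr
  rw [Real.norm_of_nonneg (by positivity), Real.norm_of_nonneg (by positivity),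
    Real.norm_of_nonneg (by positivity)]
  exact one_add_sq_rpow_le_rpow_mul hs hc ξ

lemma memLp_sobolevWeight_fhat {s : ℝ} (hs : 0 ≤ s) {f : Lp ℂ 2 (volume : Measure ℝ)}
    (hf : MemH s f) : MemLp (sobolevWeight s (fhat f)) 2 volume :=
  memLp_sobolevWeight_comp_div hs (by linarith [Real.pi_gt_three])
    (memLp_sobolevWeight_fourier hs hf)

end SobolevSpace

lemma exists_kernel_exponent {α s m : ℝ} (hα : 0 < α) (hm : 1 ≤ m) (h₁ : (1 - 2 * s) * m < 1)
    (h₂ : (1 - 2 * s) * m < 2 * α) :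
    ∃ β, 0 < β ∧ 1 - β < 2 * s ∧ 1 - 2 * α * β < 2 * s ∧ β * m < 1 := by
  have hm₀ : 0 < m := by linarith
  have hlt : max 0 (max (1 - 2 * s) ((1 - 2 * s) / (2 * α))) < 1 / m := by
    refine max_lt (by positivity) (max_lt ?_ ?_)
    · rwa [lt_div_iff₀ hm₀]
    · rw [div_lt_div_iff₀ (by positivity) hm₀]
      linarith
  obtain ⟨β, hβ, hβm⟩ := exists_between hlt
  obtain ⟨hβ₀, hβ'⟩ := max_lt_iff.mp hβ
  obtain ⟨hβ₁, hβ₂⟩ := max_lt_iff.mp hβ'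
  rw [div_lt_iff₀ (by positivity)] at hβ₂
  rw [lt_div_iff₀ hm₀] at hβm
  exact ⟨β, hβ₀, by linarith, by linarith, hβm⟩

end TangentialSchrodinger

end

theorem mainTheorem4_general (α C₁ C₂ x₀ r s p : ℝ) (hα : 0 < α) (hC₁ : 0 < C₁) (hC₂ : 0 < C₂)
    (hs : 1 / 4 < s) (hsα : 1 / 2 - α < s) (hp : 0 < p) (hp₁ : p * (1 - 2 * s) < 2)
    (hp₂ : p * (1 - 2 * s) < 4 * α) :
    TangentialSchrodinger.MaximalEstimate α C₁ C₂ x₀ r s p := by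
  have hs₀ : 0 ≤ s := by linarith
  have hm : 1 ≤ max 1 (p / 2) := le_max_left _ _
  have hpm : p ≤ 2 * max 1 (p / 2) := by linarith [le_max_right 1 (p / 2)]
  obtain ⟨β, hβ, hβs, hβα, hβm⟩ := TangentialSchrodinger.exists_kernel_exponent (s := s) hα hm
    (by rcases max_cases 1 (p / 2) with h | h <;> rw [h.1] <;> linarith)
    (by rcases max_cases 1 (p / 2) with h | h <;> rw [h.1] <;> linarith)
  obtain ⟨C, hC⟩ := TangentialSchrodinger.exists_isTruncMaximalBound hα hC₁ hC₂ hβ hs hβs hβα hm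
    hβm x₀ r
  have : IsFiniteMeasure (volume.restrict (Metric.ball x₀ r)) :=
    isFiniteMeasure_restrict.mpr measure_ball_lt_top.ne
  refine ⟨C * measureUnivNNReal (volume.restrict (Metric.ball x₀ r)) ^
    (1 / p - 1 / (2 * max 1 (p / 2))), fun γ hγ f hf => ?_⟩
  have hcar := hγ.isCaratheodory hα hC₁.le
  exact ((hC γ hγ).mono_exponent hcar hs₀ hp hpm).maximalFunction hs₀ hcar
    (ENNReal.ofReal_pos.mpr hp).ne' (TangentialSchrodinger.memLp_sobolevWeight_fhat hs₀ hf)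

theorem mainTheorem4 (α C₁ C₂ x₀ r : ℝ) (hα₀ : 0 < α) (hα₁ : α < 1) (hC₁ : 1 ≤ C₁) (hC₂ : 0 < C₂)
    (hr : 0 < r) :
    (1 / 2 ≤ α → ∀ s p : ℝ, 1 / 4 < s → 0 < p → p ≤ 4 →
      TangentialSchrodinger.MaximalEstimate α C₁ C₂ x₀ r s p) ∧
    (1 / 4 < α → α < 1 / 2 → ∀ s p : ℝ, 1 / 4 < s → 0 < p → p ≤ 8 * α →
      TangentialSchrodinger.MaximalEstimate α C₁ C₂ x₀ r s p) ∧
    (α ≤ 1 / 4 → ∀ s p : ℝ, 1 / 2 - α < s → 0 < p → p ≤ 2 →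
      TangentialSchrodinger.MaximalEstimate α C₁ C₂ x₀ r s p) := by
  refine ⟨fun hα s p hs hp hp₄ => ?_, fun hα hα' s p hs hp hp₈ => ?_, fun hα s p hs hp hp₂ => ?_⟩
  all_goals
    refine mainTheorem4_general α C₁ C₂ x₀ r s p hα₀ (by linarith) hC₂ (by linarith) (by linarith)
      hp ?_ ?_ <;> nlinarith
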